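/- Let $p$ be a prime, let $d\ge 1$, and let $G$ be a topological group isomorphic to $\mathbb{Z}_p^d$. Let $\mathbb{Z}_p[[G]]=\varprojlim_U\mathbb{Z}_p[G/U]$, where $U$ runs through the open subgroups of $G$, be its completed group algebra, with the inverse limit topology. For a $\mathbb{Z}_p[[G]]$-module $M$ and an open subgroup $U$ of $G$, let $M_U$ be the largest quotient of $M$ on which $U$ acts trivially, that is, the quotient of $M$ by the submodule generated by the elements $um-m$ with $u\in U$, $m\in M$. For open subgroups $V\subseteq U$, let $N_{U/V}\colon M_U\to M_V$ be the norm map, which sends the class of $m$ to the class of $\sum_{\tau\in U/V}\tau m$; let $\varinjlim_U M_U$ be the direct limit along these maps. The module $M$ is called systematically coinvariant-finite if $M_U$ is finite for every open subgroup $U$ of $G$. A $\mathbb{Z}_p[[G]]$-module is called pseudo-null if it is finitely generated and its localization at every prime ideal of height at most $1$ is zero. Let $M$ be a systematically coinvariant-finite $\mathbb{Z}_p[[G]]$-module which is finitely generated or, more generally, compact, i.e. admits a compact Hausdorff topology making it a topological $\mathbb{Z}_p[[G]]$-module. Then $M$ is pseudo-null over $\mathbb{Z}_p[[G]]$ if and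 only if $\varinjlim_U M_U=0$. -/

import Mathlib

namespace Iwasawa

universe u v

/-- The transition map `ℤ_p[G/V] → ℤ_p[G/U]` induced by the projection `G/V → G/U`, for open
subgroups `V ≤ U` of the commutative topological group `G`. -/
noncomputable def transition (p : ℕ) [Fact p.Prime] (G : Type u) [CommGroup G] [TopologicalSpace G]
    {V U : OpenSubgroup G} (h : V ≤ U) :
    MonoidAlgebra ℤ_[p] (G ⧸ (V : Subgroup G)) →ₐ[ℤ_[p]]
      MonoidAlgebra ℤ_[p] (G ⧸ (U : Subgroup G)) :=
  MonoidAlgebra.mapDomainAlgHom ℤ_[p] ℤ_[p]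
    (QuotientGroup.map (V : Subgroup G) (U : Subgroup G) (MonoidHom.id G) (fun _ hx => h hx))

/-- The compatible families in `∏_U ℤ_p[G/U]`, where `U` runs through the open subgroups of `G`. -/
noncomputable def compatibleFamilies (p : ℕ) [Fact p.Prime] (G : Type u) [CommGroup G]
    [TopologicalSpace G] :
    Subalgebra ℤ_[p] (∀ U : OpenSubgroup G, MonoidAlgebra ℤ_[p] (G ⧸ (U : Subgroup G))) where
  carrier := {x | ∀ (V U : OpenSubgroup G) (h : V ≤ U), transition p G h (x V) = x U}
  mul_mem' := fun ha hb V U h => by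
    simp only [Pi.mul_apply, map_mul, ha V U h, hb V U h]
  add_mem' := fun ha hb V U h => by
    simp only [Pi.add_apply, map_add, ha V U h, hb V U h]
  algebraMap_mem' := fun r V U h => by
    simp only [Pi.algebraMap_apply, AlgHom.commutes]

/-- The completed group algebra `ℤ_p⟦G⟧ = lim_U ℤ_p[G/U]`, realised as the ring of compatible
families. -/
def CompletedGroupAlgebra (p : ℕ) [Fact p.Prime] (G : Type u) [CommGroup G]
    [TopologicalSpace G] : Type u :=
  compatibleFamilies p G

noncomputable instance CompletedGroupAlgebra.instCommRing (p : ℕ) [Fact p.Prime] (G : Type u)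
    [CommGroup G] [TopologicalSpace G] : CommRing (CompletedGroupAlgebra p G) :=
  inferInstanceAs (CommRing (compatibleFamilies p G))

noncomputable instance CompletedGroupAlgebra.instAlgebra (p : ℕ) [Fact p.Prime] (G : Type u)
    [CommGroup G] [TopologicalSpace G] : Algebra ℤ_[p] (CompletedGroupAlgebra p G) :=
  inferInstanceAs (Algebra ℤ_[p] (compatibleFamilies p G))

/-- The inverse limit topology on `ℤ_p⟦G⟧`, each `ℤ_p[G/U]` having the topology of coefficientwise
`p`-adic convergence. -/
noncomputable instance CompletedGroupAlgebra.instTopologicalSpace (p : ℕ) [Fact p.Prime]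
    (G : Type u) [CommGroup G] [TopologicalSpace G] :
    TopologicalSpace (CompletedGroupAlgebra p G) :=
  TopologicalSpace.induced
    (fun x (U : OpenSubgroup G) (g : G ⧸ (U : Subgroup G)) => (x.1 U).coeff g) inferInstance

/-- The canonical map `G → ℤ_p⟦G⟧`. -/
noncomputable def grp (p : ℕ) [Fact p.Prime] (G : Type u) [CommGroup G] [TopologicalSpace G] :
    G →* CompletedGroupAlgebra p G where
  toFun g := ⟨fun U => MonoidAlgebra.of ℤ_[p] (G ⧸ (U : Subgroup G)) (g : G ⧸ (U : Subgroup G)),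
    fun V U h => by simp [transition]; rfl⟩
  map_one' := Subtype.ext (funext fun U =>
    map_one (MonoidAlgebra.of ℤ_[p] (G ⧸ (U : Subgroup G))))
  map_mul' a b := Subtype.ext (funext fun U =>
    map_mul (MonoidAlgebra.of ℤ_[p] (G ⧸ (U : Subgroup G)))
      (a : G ⧸ (U : Subgroup G)) (b : G ⧸ (U : Subgroup G)))

section Modules

variable (p : ℕ) [Fact p.Prime] (G : Type u) [CommGroup G] [TopologicalSpace G]
variable (M : Type v) [AddCommGroup M] [Module (CompletedGroupAlgebra p G) M]

/-- The submodule of `M` generated by the elements `u m - m` with `u ∈ U` and `m ∈ M`. -/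
noncomputable def coinvariantsKer (U : OpenSubgroup G) : Submodule (CompletedGroupAlgebra p G) M :=
  Submodule.span (CompletedGroupAlgebra p G) {x | ∃ u ∈ U, ∃ m : M, x = grp p G u • m - m}

/-- The module of coinvariants `M_U`, the largest quotient of `M` on which `U` acts trivially. -/
def Coinvariants (U : OpenSubgroup G) : Type v := M ⧸ coinvariantsKer p G M U

noncomputable instance Coinvariants.instAddCommGroup (U : OpenSubgroup G) :
    AddCommGroup (Coinvariants p G M U) :=
  inferInstanceAs (AddCommGroup (M ⧸ coinvariantsKer p G M U))

noncomputable instance Coinvariants.instModule (U : OpenSubgroup G) :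
    Module (CompletedGroupAlgebra p G) (Coinvariants p G M U) :=
  inferInstanceAs (Module (CompletedGroupAlgebra p G) (M ⧸ coinvariantsKer p G M U))

/-- The projection `M → M_U`. -/
noncomputable def Coinvariants.mk (U : OpenSubgroup G) :
    M →ₗ[CompletedGroupAlgebra p G] Coinvariants p G M U :=
  (coinvariantsKer p G M U).mkQ

/-- `M` is systematically coinvariant-finite if `M_U` is finite for every open subgroup `U`. -/
def IsSystematicallyCoinvariantFinite : Prop :=
  ∀ U : OpenSubgroup G, Finite (Coinvariants p G M U)

/-- The action of `G` on `M_V` factors through `G/V`. -/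
noncomputable def quotientAction (V : OpenSubgroup G) :
    G ⧸ (V : Subgroup G) →* Module.End (CompletedGroupAlgebra p G) (Coinvariants p G M V) :=
  QuotientGroup.lift (V : Subgroup G)
    ((algebraMap (CompletedGroupAlgebra p G)
      (Module.End (CompletedGroupAlgebra p G) (Coinvariants p G M V))).toMonoidHom.comp (grp p G))
    (fun u hu => by
      ext x
      obtain ⟨m, rfl⟩ := Submodule.mkQ_surjective (coinvariantsKer p G M V) x
      change (coinvariantsKer p G M V).mkQ (grp p G u • m) = (coinvariantsKer p G M V).mkQ m
      rw [← sub_eq_zero, ← map_sub, Submodule.mkQ_apply, Submodule.Quotient.mk_eq_zero]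
      exact Submodule.subset_span ⟨u, hu, m, rfl⟩)

/-- The subgroup `U/V` of `G/V`, for open subgroups `V ≤ U`. -/
def relQuotient (U V : OpenSubgroup G) : Subgroup (G ⧸ (V : Subgroup G)) :=
  (U : Subgroup G).map (QuotientGroup.mk' (V : Subgroup G))

/-- The endomorphism `y ↦ ∑_{τ ∈ U/V} τ y` of `M_V`. (For `G` compact the group `U/V` is finite,
so that the sum is a finite one.) -/
noncomputable def normEnd (U V : OpenSubgroup G) :
    Module.End (CompletedGroupAlgebra p G) (Coinvariants p G M V) :=
  ∑ᶠ τ : relQuotient G U V, quotientAction p G M V τ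

theorem normEnd_comp (U V : OpenSubgroup G) (u : G) (hu : u ∈ U) :
    normEnd p G M U V * quotientAction p G M V (u : G ⧸ (V : Subgroup G)) = normEnd p G M U V := by
  by_cases hf : (Function.support
      (fun τ : relQuotient G U V => quotientAction p G M V (τ : G ⧸ (V : Subgroup G)))).Finite
  · have hmem : (u : G ⧸ (V : Subgroup G)) ∈ relQuotient G U V := ⟨u, hu, rfl⟩
    have h1 := (AddMonoidHom.mulRight (quotientAction p G M V
      (u : G ⧸ (V : Subgroup G)))).map_finsum hf
    simp only [AddMonoidHom.coe_mulRight] at h1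
    unfold normEnd
    rw [h1]
    have h2 := finsum_comp_equiv (Equiv.mulRight (⟨_, hmem⟩ : relQuotient G U V))
      (f := fun τ : relQuotient G U V => quotientAction p G M V (τ : G ⧸ (V : Subgroup G)))
    rw [← h2]
    simp
  · have : normEnd p G M U V = 0 := finsum_of_infinite_support hf
    rw [this, zero_mul]

/-- The norm map `N_{U/V} : M_U → M_V` for open subgroups `V ≤ U`: it sends the class of `m` to
`∑_{τ ∈ U/V} τ m`. -/
noncomputable def normMap (U V : OpenSubgroup G) :
    Coinvariants p G M U →ₗ[CompletedGroupAlgebra p G] Coinvariants p G M V :=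
  (coinvariantsKer p G M U).liftQ
    ((normEnd p G M U V).comp (Coinvariants.mk p G M V))
    (Submodule.span_le.2 (by
      rintro _ ⟨u, hu, m, rfl⟩
      have h := LinearMap.congr_fun (normEnd_comp p G M U V u hu) (Coinvariants.mk p G M V m)
      have h' : quotientAction p G M V (u : G ⧸ (V : Subgroup G)) (Coinvariants.mk p G M V m)
          = Coinvariants.mk p G M V (grp p G u • m) := rfl
      rw [Module.End.mul_apply, h'] at h
      change normEnd p G M U V (Coinvariants.mk p G M V (grp p G u • m - m)) = 0
      rw [map_sub, map_sub, h, sub_self]))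

open Classical in
/-- The direct limit `colim_U M_U` along the norm maps, over the open subgroups of `G` ordered by
reverse inclusion. -/
abbrev CoinvariantsLimit : Type (max u v) :=
  Module.DirectLimit (R := CompletedGroupAlgebra p G) (ι := (OpenSubgroup G)ᵒᵈ)
    (fun U => Coinvariants p G M (OrderDual.ofDual U))
    (fun U V _ => normMap p G M (OrderDual.ofDual U) (OrderDual.ofDual V))

/-- `M` is a compact `ℤ_p⟦G⟧`-module: it carries a compact Hausdorff topology for which it is a
topological module over `ℤ_p⟦G⟧`. -/
def IsCompactModule : Prop :=
  ∃ _ : TopologicalSpace M, CompactSpace M ∧ T2Space M ∧ IsTopologicalAddGroup M ∧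
    ContinuousSMul (CompletedGroupAlgebra p G) M

end Modules

/-- A module over a commutative ring is pseudo-null if it is finitely generated and its
localization at every prime ideal of height at most one vanishes. -/
def IsPseudoNull (R : Type u) [CommRing R] (M : Type v) [AddCommGroup M] [Module R M] : Prop :=
  Module.Finite R M ∧ ∀ P : PrimeSpectrum R, P.asIdeal.height ≤ 1 →
    Subsingleton (LocalizedModule P.asIdeal.primeCompl M)

end Iwasawa

/-! Write R = ℤ_p⟦G⟧ and let I_U be the kernel of R → ℤ_p[G/U]; it is generated by the u - 1 with u
∈ U (`kerProj_eq_augIdeal`), so M_U = M / I_U M. Since R ≅ ℤ_p⟦T₁, …, T_d⟧, it is a Noetherian,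
completely integrally closed domain, and the primes associated to a nonzero principal ideal have
height at most one. R is also compact, so its ideals are closed and can be tested at finite level.
If ν ∈ R lifts ∑_{τ ∈ U/V} τ, the direct limit vanishes exactly when for all U and m some V ≤ U has
ν m ∈ I_V M. Finiteness of M_U and the determinant trick give some f ∈ Ann M with f ≡ p^k mod I_U;
such an f is a nonzerodivisor on ℤ_p[G/U].

Suppose M is pseudo-null. Ann M lies in no prime of height at most one, so prime avoidance gives g ∈
Ann M regular modulo f. The self-duality of ℤ/p^n[G/V] and a compactness argument put ν into (f, g)
+ I_V for some V (`exists_normElt_sub_mem`), whence ν m ∈ I_V M.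

Suppose the limit vanishes but M_P ≠ 0 with P of height at most one. Then P is associated to some
R/(b), say P = (b : a), and there is a nonzero φ : M → R/P. If φ(m) is the class of s, then b
divides (ν s - κ) a with κ ∈ I_V, for every U and a suitable V. A descent from level V to level U
(`dvd_of_forall_exists_normElt`) yields b ∣ s a, that is φ(m) = 0.

Compact modules reduce to finitely generated ones by a topological Nakayama lemma. -/

/-- If every power of `b` divides `c * a ^ n`, for a fixed nonzero `c`, then `b` divides `a`:
a domain with this property is completely integrally closed. -/
def IsCompletelyIntegrallyClosed (R : Type*) [CommRing R] : Prop :=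
  ∀ a b c : R, b ≠ 0 → c ≠ 0 → (∀ n : ℕ, b ^ n ∣ c * a ^ n) → b ∣ a

/-! ### Complete integral closedness of power series rings, and primes of height at most one -/

namespace IsCompletelyIntegrallyClosed

/-- The hypothesis says that a / b is almost integral; over a Noetherian ring this means integral.
-/
theorem of_isIntegrallyClosed (R : Type*) [CommRing R] [IsDomain R] [IsNoetherianRing R]
    [IsIntegrallyClosed R] : IsCompletelyIntegrallyClosed R := by
  intro a b c hb hc h
  have hb' : algebraMap R (FractionRing R) b ≠ 0 := by simpa using hb
  have hi : IsAlmostIntegral R (algebraMap R (FractionRing R) a / algebraMap R _ b) := by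
    refine ⟨c, mem_nonZeroDivisors_of_ne_zero hc, fun n => ?_⟩
    obtain ⟨e, he⟩ := h n
    refine ⟨e, ?_⟩
    rw [Algebra.smul_def, div_pow, mul_div, ← map_pow, ← map_pow, ← map_mul, he, map_mul,
      mul_div_cancel_left₀]
    rw [map_pow]
    exact pow_ne_zero _ hb'
  obtain ⟨e, he⟩ := IsIntegrallyClosed.isIntegral_iff.1 hi.isIntegral
  refine ⟨e, FaithfulSMul.algebraMap_injective R (FractionRing R) ?_⟩
  rw [map_mul, he, mul_div_cancel₀ _ hb']

theorem of_ringEquiv {R S : Type*} [CommRing R] [CommRing S] (e : R ≃+* S)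
    (h : IsCompletelyIntegrallyClosed R) : IsCompletelyIntegrallyClosed S := by
  intro a b c hb hc hn
  have := h (e.symm a) (e.symm b) (e.symm c) (by simpa using hb) (by simpa using hc) (fun n => by
    simpa using map_dvd e.symm (hn n))
  simpa using map_dvd e this

open PowerSeries in
-- The element a is approximated by multiples of b modulo X ^ N, one coefficient at a time: the
-- lowest coefficient of the error satisfies the same divisibility over A. Krull's intersection
-- theorem then gives a ∈ (b).
theorem powerSeries {A : Type*} [CommRing A] [IsDomain A] [IsNoetherianRing A]
    (h : IsCompletelyIntegrallyClosed A) : IsCompletelyIntegrallyClosed A⟦X⟧ := by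
  intro a b c hb hc hn
  have key : ∀ N : ℕ, ∃ e : A⟦X⟧, (X : A⟦X⟧) ^ N ∣ a - e * b := by
    intro N
    induction N with
    | zero => exact ⟨0, by simp⟩
    | succ N ih =>
      obtain ⟨e, a₂, he⟩ := ih
      by_cases ha₂ : constantCoeff a₂ = 0
      · obtain ⟨a₃, ha₃⟩ := X_dvd_iff.2 ha₂
        exact ⟨e, a₃, by rw [he, ha₃]; ring⟩
      -- By the binomial theorem, the hypothesis on a passes to a - e b.
      have hdiv : ∀ n : ℕ, b ^ n ∣ c * (X ^ N * a₂) ^ n := by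
        intro n
        rw [← he, sub_eq_add_neg, add_pow, Finset.mul_sum]
        refine Finset.dvd_sum fun i hi => ?_
        rw [Finset.mem_range, Nat.lt_succ_iff] at hi
        obtain ⟨w, hw⟩ := hn i
        refine ⟨w * (-e) ^ (n - i) * (n.choose i : A⟦X⟧), ?_⟩
        calc c * (a ^ i * (-(e * b)) ^ (n - i) * (n.choose i : A⟦X⟧))
            = (c * a ^ i) * ((-e) ^ (n - i) * b ^ (n - i)) * (n.choose i : A⟦X⟧) := by
              rw [← mul_pow, neg_mul]; ring
          _ = b ^ i * b ^ (n - i) * (w * (-e) ^ (n - i) * (n.choose i : A⟦X⟧)) := by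
              rw [hw]; ring
          _ = _ := by rw [← pow_add, Nat.add_sub_cancel' hi]
      obtain ⟨s, b₁, hb₁, rfl⟩ : ∃ s : ℕ, ∃ b₁ : A⟦X⟧, constantCoeff b₁ ≠ 0 ∧ b = X ^ s * b₁ :=
        ⟨b.order.toNat, b.divXPowOrder,
          by simpa [constantCoeff_divXPowOrder_eq_zero_iff] using hb,
          X_pow_order_mul_divXPowOrder.symm⟩
      obtain ⟨t, c₁, hc₁, rfl⟩ : ∃ t : ℕ, ∃ c₁ : A⟦X⟧, constantCoeff c₁ ≠ 0 ∧ c = X ^ t * c₁ :=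
        ⟨c.order.toNat, c.divXPowOrder,
          by simpa [constantCoeff_divXPowOrder_eq_zero_iff] using hc,
          X_pow_order_mul_divXPowOrder.symm⟩
      have hXd : ∀ (i j : ℕ) (u : A⟦X⟧), constantCoeff u ≠ 0 → X ^ i ∣ X ^ j * u → i ≤ j := by
        intro i j u hu hij
        by_contra hlt
        rw [not_le] at hlt
        obtain ⟨k, rfl⟩ := Nat.exists_eq_add_of_lt hlt
        rw [add_assoc, pow_add, mul_dvd_mul_iff_left (pow_ne_zero _ X_ne_zero)] at hij
        exact hu (X_dvd_iff.1 ((dvd_pow_self X (Nat.succ_ne_zero k)).trans hij))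
      have hexp : ∀ n : ℕ, X ^ t * c₁ * (X ^ N * a₂) ^ n = X ^ (t + n * N) * (c₁ * a₂ ^ n) := by
        intro n; rw [mul_pow, ← pow_mul, pow_add, mul_comm n N]; ring
      have hnz : ∀ n : ℕ, constantCoeff (c₁ * a₂ ^ n) ≠ 0 := by
        intro n; rw [map_mul, map_pow]; exact mul_ne_zero hc₁ (pow_ne_zero _ ha₂)
      have hsN : s ≤ N := by
        -- Comparing X-orders in the (t + 1)-st power makes the order t of c negligible: s ≥ N + 1
        -- would force (t + 1)(N + 1) ≤ t + (t + 1) N.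
        have h1 : s * (t + 1) ≤ t + (t + 1) * N := by
          refine hXd _ _ _ (hnz (t + 1)) ?_
          rw [← hexp, pow_mul]
          exact (pow_dvd_pow_of_dvd (dvd_mul_right _ _) _).trans (hdiv (t + 1))
        by_contra hlt
        nlinarith
      have hcc : constantCoeff b₁ ∣ constantCoeff a₂ := by
        refine h _ _ (constantCoeff c₁) hb₁ hc₁ fun n => ?_
        obtain ⟨w, hw⟩ := hdiv n
        rw [hexp, mul_pow, ← pow_mul, mul_assoc] at hw
        have hle : s * n ≤ t + n * N := by nlinarith
        obtain ⟨k, hk⟩ := Nat.exists_eq_add_of_le hle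
        rw [hk, pow_add, mul_assoc] at hw
        have hw' := mul_left_cancel₀ (pow_ne_zero _ X_ne_zero) hw
        have hXw : X ^ k ∣ w := by
          have hp : Prime (X : A⟦X⟧) := X_prime
          refine hp.pow_dvd_of_dvd_mul_left k ?_ ⟨_, hw'.symm⟩
          rw [X_dvd_iff, map_pow]
          exact pow_ne_zero _ hb₁
        obtain ⟨w₁, rfl⟩ := hXw
        have hw'' : c₁ * a₂ ^ n = b₁ ^ n * w₁ :=
          mul_left_cancel₀ (pow_ne_zero k X_ne_zero) (hw'.trans (by ring))
        have := congrArg (constantCoeff (R := A)) hw''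
        simp only [map_mul, map_pow] at this
        exact ⟨_, this⟩
      obtain ⟨e₀, he₀⟩ := hcc
      have hX : X ∣ a₂ - C e₀ * b₁ := by
        rw [X_dvd_iff, map_sub, map_mul, constantCoeff_C, he₀]; ring
      obtain ⟨a₃, ha₃⟩ := hX
      obtain ⟨k, rfl⟩ := Nat.exists_eq_add_of_le hsN
      refine ⟨e + C e₀ * X ^ k, a₃, ?_⟩
      calc a - (e + C e₀ * X ^ k) * (X ^ s * b₁)
          = (a - e * (X ^ s * b₁)) - C e₀ * X ^ k * (X ^ s * b₁) := by ring
        _ = X ^ (s + k) * (a₂ - C e₀ * b₁) := by rw [he]; ring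
        _ = _ := by rw [ha₃]; ring
  -- X lies in the Jacobson radical, so the X-adic topology on A⟦X⟧/(b) is separated.
  have hjac : Ideal.span {(X : A⟦X⟧)} ≤ Ideal.jacobson ⊥ := by
    rw [Ideal.span_singleton_le_iff_mem, Ideal.mem_jacobson_bot]
    intro y
    rw [isUnit_iff_constantCoeff]
    simp
  have hinf := Ideal.iInf_pow_smul_eq_bot_of_le_jacobson (M := A⟦X⟧ ⧸ Ideal.span {b}) _ hjac
  rw [← Ideal.mem_span_singleton, ← Ideal.Quotient.eq_zero_iff_mem, ← Submodule.mem_bot A⟦X⟧,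
    ← hinf, Submodule.mem_iInf]
  intro N
  obtain ⟨e, w, he⟩ := key N
  have : Ideal.Quotient.mk (Ideal.span {b}) a = (X ^ N : A⟦X⟧) • Ideal.Quotient.mk _ w := by
    rw [← sub_add_cancel a (e * b), he, map_add, Ideal.Quotient.eq_zero_iff_mem.2
      (Ideal.mem_span_singleton'.2 ⟨e, rfl⟩), add_zero]
    rfl
  rw [this]
  exact Submodule.smul_mem_smul (Ideal.pow_mem_pow (Ideal.mem_span_singleton_self _) N) trivial

theorem mvPowerSeries {A : Type*} [CommRing A] [IsDomain A] [IsNoetherianRing A]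
    (h : IsCompletelyIntegrallyClosed A) (n : ℕ) :
    IsCompletelyIntegrallyClosed (MvPowerSeries (Fin n) A) := by
  induction n with
  | zero => exact h.of_ringEquiv (MvPowerSeries.isEmptyEquiv A (σ := Fin 0)).symm.toRingEquiv
  | succ n ih =>
    have : IsDomain (MvPowerSeries (Fin n) A) := NoZeroDivisors.to_isDomain _
    exact ih.powerSeries.of_ringEquiv (MvPowerSeries.finSuccEquiv A n).symm.toRingEquiv

/-- In a completely integrally closed Noetherian domain the associated primes of a nonzero
principal ideal have height at most one. -/
theorem height_le_one {R : Type*} [CommRing R] [IsDomain R] [IsNoetherianRing R]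
    (h : IsCompletelyIntegrallyClosed R) {f : R} (hf : f ≠ 0) {P : Ideal R}
    (hP : P ∈ associatedPrimes R (R ⧸ Ideal.span {f})) : P.height ≤ 1 := by
  rw [AssociatedPrimes.mem_iff, isAssociatedPrime_iff] at hP
  obtain ⟨hprime, x, hx⟩ := hP
  obtain ⟨x, rfl⟩ := Ideal.Quotient.mk_surjective x
  have hmem : ∀ r, r ∈ P ↔ f ∣ r * x := by
    intro r
    rw [hx, Submodule.mem_colon_singleton, Submodule.mem_bot, ← Ideal.mem_span_singleton,
      ← Ideal.Quotient.eq_zero_iff_mem]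
    rfl
  have hfP : f ∈ P := (hmem f).2 (dvd_mul_right _ _)
  have hfx : ¬ f ∣ x := fun hd => hprime.ne_top ((Ideal.eq_top_iff_one _).2 ((hmem 1).2 (by simpa)))
  -- Otherwise multiplication by x / f maps P into itself. Then f (x / f) ^ n ∈ P for all n, and
  -- complete integral closedness gives f ∣ x.
  obtain ⟨c, hc, u, hu, huP⟩ : ∃ c ∈ P, ∃ u, c * x = f * u ∧ u ∉ P := by
    by_contra hcon
    push Not at hcon
    refine hfx (h x f f hf hf fun n => ?_)
    suffices ∃ y ∈ P, f * x ^ n = f ^ n * y by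
      obtain ⟨y, -, hy⟩ := this
      exact ⟨y, hy⟩
    induction n with
    | zero => exact ⟨f, hfP, by simp⟩
    | succ n ih =>
      obtain ⟨y, hy, hyn⟩ := ih
      obtain ⟨w, hw⟩ := (hmem y).1 hy
      exact ⟨w, hcon y hy w hw, by rw [pow_succ, ← mul_assoc, hyn, mul_assoc, hw]; ring⟩
  -- As u is a unit at P and u y ∈ (c) for all y ∈ P, the ideal P is generated by c locally at P;
  -- Krull's principal ideal theorem applies.
  have hmin : P ∈ (Ideal.span {c}).minimalPrimes := by
    refine ⟨⟨hprime, by rwa [Ideal.span_singleton_le_iff_mem]⟩, ?_⟩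
    rintro Q ⟨hQ, hcQ⟩ hQP y hy
    rw [Ideal.span_singleton_le_iff_mem] at hcQ
    obtain ⟨w, hw⟩ := (hmem y).1 hy
    have huy : u * y = c * w := by
      refine mul_left_cancel₀ hf ?_
      rw [← mul_assoc, ← hu, mul_right_comm, mul_assoc c y x, hw]; ring
    have : u * y ∈ Q := huy ▸ Ideal.mul_mem_right _ _ hcQ
    exact (hQ.mem_or_mem this).resolve_left fun hu' => huP (hQP hu')
  exact Ideal.height_le_one_of_isPrincipal_of_mem_minimalPrimes _ _ hmin

end IsCompletelyIntegrallyClosed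

theorem Ideal.mem_minimalPrimes_span_singleton_of_height_le_one {R : Type*} [CommRing R]
    [IsDomain R] {P : Ideal R} [hP : P.IsPrime] (h : P.height ≤ 1) {b : R} (hb : b ∈ P)
    (hb0 : b ≠ 0) : P ∈ (Ideal.span {b}).minimalPrimes := by
  refine ⟨⟨hP, by rwa [Ideal.span_singleton_le_iff_mem]⟩, ?_⟩
  rintro Q ⟨hQ, hbQ⟩ hQP
  rw [Ideal.span_singleton_le_iff_mem] at hbQ
  by_contra hPQ
  have h1 := (Ideal.height_add_one_le_of_lt_of_isPrime (lt_of_le_not_ge hQP hPQ)).trans h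
  have h2 : Q.height = 0 := by
    have : Q.height + 1 ≤ 0 + 1 := by simpa using h1
    simpa using (ENat.add_le_add_iff_right ENat.one_ne_top).1 this
  rw [Ideal.height_eq_zero_iff_eq_bot] at h2
  rw [h2, Ideal.mem_bot] at hbQ
  exact hb0 hbQ

namespace Iwasawa

universe u v

open Topology Filter

theorem algebraMap_dvd_monoidAlgebra_iff {R H : Type*} [CommRing R] [CommGroup H] [Finite H]
    (q : R) (x : MonoidAlgebra R H) :
    algebraMap R (MonoidAlgebra R H) q ∣ x ↔ ∀ g, q ∣ x.coeff g := by
  constructor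
  · rintro ⟨y, rfl⟩ g
    rw [← Algebra.smul_def]
    exact ⟨y.coeff g, rfl⟩
  · intro h
    choose y hy using h
    refine ⟨MonoidAlgebra.ofCoeff (Finsupp.equivFunOnFinite.symm y), ?_⟩
    ext g
    rw [← Algebra.smul_def, MonoidAlgebra.coeff_smul_apply, hy]
    rfl

theorem coeff_of_mul {R H : Type*} [CommRing R] [CommGroup H] (τ : H) (x : MonoidAlgebra R H)
    (g : H) : (MonoidAlgebra.of R H τ * x).coeff g = x.coeff (τ⁻¹ * g) := by
  rw [MonoidAlgebra.of_apply, MonoidAlgebra.coeff_single_mul_eq_mul_coeff (τ⁻¹ * g), one_mul]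
  exact fun _ _ => eq_inv_mul_iff_mul_eq.symm

theorem coeff_mul_eq_sum {R H : Type*} [CommRing R] [CommGroup H] [Fintype H]
    (x y : MonoidAlgebra R H) (g : H) : (x * y).coeff g = ∑ h, x.coeff h * y.coeff (h⁻¹ * g) := by
  classical
  rw [MonoidAlgebra.coeff_mul, Finsupp.sum_fintype _ _ (by simp)]
  refine Finset.sum_congr rfl fun h _ => ?_
  rw [Finsupp.sum_fintype _ _ (by simp)]
  simp_rw [← eq_inv_mul_iff_mul_eq (b := h)]
  simp

/-- Finitely generated submodules over a compact ring are compact. -/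
theorem isCompact_of_fg {R M : Type*} [CommRing R] [TopologicalSpace R] [CompactSpace R]
    [AddCommGroup M] [Module R M] [TopologicalSpace M] [ContinuousAdd M] [ContinuousSMul R M]
    {N : Submodule R M} (hN : N.FG) : IsCompact (N : Set M) := by
  obtain ⟨n, s, rfl⟩ := Submodule.fg_iff_exists_fin_generating_family.1 hN
  have : (Submodule.span R (Set.range s) : Set M) =
      Set.range fun c : Fin n → R => ∑ i, c i • s i := by
    ext x
    exact Submodule.mem_span_range_iff_exists_fun R
  rw [this]
  exact isCompact_range (continuous_finsetSum _ fun i _ =>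
    (continuous_apply i).smul continuous_const)

/-! ### Finite levels and the ideals defining the topology -/

section Basic

variable (p : ℕ) [Fact p.Prime] {G : Type u} [CommGroup G] [TopologicalSpace G]

/-- The projection `ℤ_p⟦G⟧ → ℤ_p[G/U]`. -/
noncomputable def proj (U : OpenSubgroup G) :
    CompletedGroupAlgebra p G →ₐ[ℤ_[p]] MonoidAlgebra ℤ_[p] (G ⧸ (U : Subgroup G)) :=
  (Pi.evalAlgHom ℤ_[p] _ U).comp (compatibleFamilies p G).val

theorem proj_grp (U : OpenSubgroup G) (g : G) :
    proj p U (grp p G g) = MonoidAlgebra.of ℤ_[p] (G ⧸ (U : Subgroup G)) g := rfl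

theorem transition_proj {V U : OpenSubgroup G} (h : V ≤ U) (x : CompletedGroupAlgebra p G) :
    transition p G h (proj p V x) = proj p U x := x.2 V U h

variable {p} in
theorem proj_ext {x y : CompletedGroupAlgebra p G} (h : ∀ U, proj p U x = proj p U y) : x = y :=
  Subtype.ext (funext h)

variable {p} in
theorem proj_eq_of_le {V U : OpenSubgroup G} (h : V ≤ U) {x y : CompletedGroupAlgebra p G}
    (hxy : proj p V x = proj p V y) : proj p U x = proj p U y := by
  rw [← transition_proj p h, hxy, transition_proj]

theorem proj_surjective (U : OpenSubgroup G) : Function.Surjective (proj p U) := by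
  intro x
  induction x using MonoidAlgebra.induction_linear with
  | zero => exact ⟨0, map_zero _⟩
  | add x y hx hy =>
    obtain ⟨a, rfl⟩ := hx
    obtain ⟨b, rfl⟩ := hy
    exact ⟨a + b, map_add _ _ _⟩
  | single m r =>
    obtain ⟨g, rfl⟩ := QuotientGroup.mk_surjective m
    refine ⟨r • grp p G g, ?_⟩
    rw [map_smul, proj_grp, MonoidAlgebra.of_apply, MonoidAlgebra.smul_single, smul_eq_mul, mul_one]

/-- The kernel of the projection `ℤ_p⟦G⟧ → ℤ_p[G/U]`. -/
noncomputable def kerProj (U : OpenSubgroup G) : Ideal (CompletedGroupAlgebra p G) :=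
  RingHom.ker (proj p U)

variable {p} in
theorem mem_kerProj {U : OpenSubgroup G} {x : CompletedGroupAlgebra p G} :
    x ∈ kerProj p U ↔ proj p U x = 0 := RingHom.mem_ker

theorem kerProj_mono {V U : OpenSubgroup G} (h : V ≤ U) : kerProj p V ≤ kerProj p U := by
  intro x hx
  rw [mem_kerProj] at hx ⊢
  rw [← transition_proj p h, hx, map_zero]

theorem grp_sub_one_mem_kerProj {U : OpenSubgroup G} {u : G} (hu : u ∈ U) :
    grp p G u - 1 ∈ kerProj p U := by
  rw [mem_kerProj, map_sub, proj_grp, map_one, (QuotientGroup.eq_one_iff u).2 hu, map_one,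
    sub_self]

/-- The elements of `ℤ_p⟦G⟧` whose image in `ℤ_p[G/U]` is divisible by `p ^ n`. -/
noncomputable def levelIdeal (U : OpenSubgroup G) (n : ℕ) : Ideal (CompletedGroupAlgebra p G) :=
  (Ideal.span {(p : MonoidAlgebra ℤ_[p] (G ⧸ (U : Subgroup G))) ^ n}).comap (proj p U)

variable {p} in
theorem mem_levelIdeal {U : OpenSubgroup G} {n : ℕ} {x : CompletedGroupAlgebra p G} :
    x ∈ levelIdeal p U n ↔ (p : MonoidAlgebra ℤ_[p] (G ⧸ (U : Subgroup G))) ^ n ∣ proj p U x := by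
  rw [levelIdeal, Ideal.mem_comap, Ideal.mem_span_singleton]

variable {p} in
theorem mem_levelIdeal_iff_exists {U : OpenSubgroup G} {n : ℕ} {x : CompletedGroupAlgebra p G} :
    x ∈ levelIdeal p U n ↔ ∃ y, x - (p : CompletedGroupAlgebra p G) ^ n * y ∈ kerProj p U := by
  rw [mem_levelIdeal]
  constructor
  · rintro ⟨y, hy⟩
    obtain ⟨y, rfl⟩ := proj_surjective p U y
    exact ⟨y, by rw [mem_kerProj, map_sub, hy]; simp⟩
  · rintro ⟨y, hy⟩
    rw [mem_kerProj, map_sub, sub_eq_zero] at hy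
    exact ⟨proj p U y, by rw [hy]; simp⟩

theorem kerProj_le_levelIdeal (U : OpenSubgroup G) (n : ℕ) : kerProj p U ≤ levelIdeal p U n :=
  fun x hx => mem_levelIdeal.2 (by rw [mem_kerProj.1 hx]; exact dvd_zero _)

theorem pow_mem_levelIdeal (U : OpenSubgroup G) (n : ℕ) :
    (p : CompletedGroupAlgebra p G) ^ n ∈ levelIdeal p U n :=
  mem_levelIdeal.2 (by simp)

theorem levelIdeal_mono {V U : OpenSubgroup G} (h : V ≤ U) {m n : ℕ} (hmn : m ≤ n) :
    levelIdeal p V n ≤ levelIdeal p U m := by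
  intro x hx
  rw [mem_levelIdeal_iff_exists] at hx ⊢
  obtain ⟨y, hy⟩ := hx
  refine ⟨(p : CompletedGroupAlgebra p G) ^ (n - m) * y, ?_⟩
  rw [← mul_assoc, ← pow_add, Nat.add_sub_cancel' hmn]
  exact kerProj_mono p h hy

theorem levelIdeal_antitone :
    Antitone fun i : (OpenSubgroup G)ᵒᵈ × ℕ => levelIdeal p (OrderDual.ofDual i.1) i.2 :=
  fun _ _ hij => levelIdeal_mono p hij.1 hij.2

end Basic

/-! ### The compact topology of ℤ_p⟦G⟧ -/

section Topology

variable (p : ℕ) [Fact p.Prime] (G : Type u) [CommGroup G] [TopologicalSpace G]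

/-- All coefficients of an element of `ℤ_p⟦G⟧` at all finite levels. -/
noncomputable def coeffs (x : CompletedGroupAlgebra p G) (U : OpenSubgroup G)
    (g : G ⧸ (U : Subgroup G)) : ℤ_[p] :=
  (proj p U x).coeff g

theorem isInducing_coeffs : IsInducing (coeffs p G) := ⟨rfl⟩

theorem coeffs_injective : Function.Injective (coeffs p G) := fun _ _ h =>
  proj_ext fun U => MonoidAlgebra.ext (Finsupp.ext fun g => congrFun (congrFun h U) g)

variable {G} in
theorem continuous_coeff_proj (U : OpenSubgroup G) (g : G ⧸ (U : Subgroup G)) :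
    Continuous fun x : CompletedGroupAlgebra p G => (proj p U x).coeff g :=
  continuous_pi_iff.1 (continuous_pi_iff.1 (isInducing_coeffs p G).continuous U) g

theorem continuous_iff_coeff_proj {X : Type*} [TopologicalSpace X]
    {f : X → CompletedGroupAlgebra p G} :
    Continuous f ↔ ∀ U g, Continuous fun x => (proj p U (f x)).coeff g := by
  rw [(isInducing_coeffs p G).continuous_iff, continuous_pi_iff]
  simp_rw [continuous_pi_iff]
  rfl

instance : T2Space (CompletedGroupAlgebra p G) :=
  T2Space.of_injective_continuous (coeffs_injective p G) (isInducing_coeffs p G).continuous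

variable {G} in
/-- The projection `G/V → G/U`. -/
def levelMap {V U : OpenSubgroup G} (h : V ≤ U) : G ⧸ (V : Subgroup G) →* G ⧸ (U : Subgroup G) :=
  QuotientGroup.map (V : Subgroup G) (U : Subgroup G) (MonoidHom.id G) (fun _ hx => h hx)

variable {G} in
theorem levelMap_mk {V U : OpenSubgroup G} (h : V ≤ U) (g : G) :
    levelMap h (g : G ⧸ (V : Subgroup G)) = (g : G ⧸ (U : Subgroup G)) := rfl

theorem coeff_transition {V U : OpenSubgroup G} (h : V ≤ U) [Finite (G ⧸ (V : Subgroup G))]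
    (x : MonoidAlgebra ℤ_[p] (G ⧸ (V : Subgroup G))) (g : G ⧸ (U : Subgroup G)) :
    (transition p G h x).coeff g =
      ∑ᶠ (a : G ⧸ (V : Subgroup G)) (_ : levelMap h a = g), x.coeff a := by
  classical
  have := Fintype.ofFinite (G ⧸ (V : Subgroup G))
  change Finsupp.mapDomain (levelMap h) x.coeff g = _
  rw [Finsupp.mapDomain, Finsupp.sum_fintype _ _ (by simp), Finsupp.finsetSum_apply,
    finsum_eq_sum_of_fintype]
  refine Finset.sum_congr rfl fun a _ => ?_
  rw [Finsupp.single_apply]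
  split_ifs with hh
  · exact (finsum_eq_if.trans (if_pos hh)).symm
  · exact (finsum_eq_if.trans (if_neg hh)).symm

variable {G} in
theorem isClosed_setOf_proj_eq (U : OpenSubgroup G) (x : CompletedGroupAlgebra p G) :
    IsClosed {c | proj p U c = proj p U x} := by
  have : {c | proj p U c = proj p U x} =
      ⋂ g, {c | (proj p U c).coeff g = (proj p U x).coeff g} := by
    ext c
    simp only [Set.mem_ofPred_eq, Set.mem_iInter]
    exact ⟨fun h g => by rw [h], fun h => MonoidAlgebra.ext (Finsupp.ext h)⟩
  rw [this]
  exact isClosed_iInter fun g => isClosed_eq (continuous_coeff_proj p U g) continuous_const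

variable [IsTopologicalGroup G] [CompactSpace G]

instance finite_quotient_openSubgroup (U : OpenSubgroup G) : Finite (G ⧸ (U : Subgroup G)) :=
  U.toSubgroup.quotient_finite_of_isOpen U.isOpen

instance : IsTopologicalRing (CompletedGroupAlgebra p G) where
  continuous_add := by
    refine (continuous_iff_coeff_proj p G).2 fun U g => ?_
    simp only [map_add, MonoidAlgebra.coeff_add, Finsupp.add_apply]
    exact ((continuous_coeff_proj p U g).comp continuous_fst).add
      ((continuous_coeff_proj p U g).comp continuous_snd)
  continuous_mul := by
    refine (continuous_iff_coeff_proj p G).2 fun U g => ?_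
    have := Fintype.ofFinite (G ⧸ (U : Subgroup G))
    simp only [map_mul, coeff_mul_eq_sum]
    exact continuous_finsetSum _ fun h _ => ((continuous_coeff_proj p U h).comp continuous_fst).mul
      ((continuous_coeff_proj p U _).comp continuous_snd)
  continuous_neg := by
    refine (continuous_iff_coeff_proj p G).2 fun U g => ?_
    simp only [map_neg, MonoidAlgebra.coeff_neg, Finsupp.neg_apply]
    exact (continuous_coeff_proj p U g).neg

instance : ContinuousSMul ℤ_[p] (CompletedGroupAlgebra p G) where
  continuous_smul := by
    refine (continuous_iff_coeff_proj p G).2 fun U g => ?_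
    simp only [map_smul, MonoidAlgebra.coeff_smul_apply, smul_eq_mul]
    exact continuous_fst.mul ((continuous_coeff_proj p U g).comp continuous_snd)

theorem range_coeffs : Set.range (coeffs p G) = {y | ∀ (V U : OpenSubgroup G) (h : V ≤ U)
    (g : G ⧸ (U : Subgroup G)), ∑ᶠ (a : G ⧸ (V : Subgroup G)) (_ : levelMap h a = g), y V a
      = y U g} := by
  ext y
  constructor
  · rintro ⟨x, rfl⟩ V U h g
    refine (coeff_transition p G h (proj p V x) g).symm.trans ?_
    exact congrArg (fun z => z.coeff g) (transition_proj p h x)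
  · intro hy
    refine ⟨⟨fun U => MonoidAlgebra.ofCoeff (Finsupp.equivFunOnFinite.symm (y U)), ?_⟩, rfl⟩
    intro V U h
    ext g
    exact (coeff_transition p G h _ g).trans (hy V U h g)

instance : CompactSpace (CompletedGroupAlgebra p G) := by
  have hc : IsClosed (Set.range (coeffs p G)) := by
    rw [range_coeffs]
    simp only [Set.ofPred_forall]
    refine isClosed_iInter fun V => isClosed_iInter fun U => isClosed_iInter fun h =>
      isClosed_iInter fun g => isClosed_eq ?_ ((continuous_apply g).comp (continuous_apply U))
    have := Fintype.ofFinite (G ⧸ (V : Subgroup G))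
    simp_rw [finsum_eq_sum_of_fintype]
    classical
    refine continuous_finsetSum _ fun a _ => ?_
    simp_rw [finsum_eq_if]
    split_ifs
    · exact (continuous_apply a).comp (continuous_apply V)
    · exact continuous_const
  exact (IsClosedEmbedding.mk ⟨isInducing_coeffs p G, coeffs_injective p G⟩ hc).compactSpace

variable {p G}

/-- A closed subset of `ℤ_p⟦G⟧` is determined by its images at finite level. -/
theorem mem_of_isClosed_of_forall_proj {C : Set (CompletedGroupAlgebra p G)} (hC : IsClosed C)
    {x : CompletedGroupAlgebra p G} (h : ∀ U, ∃ c ∈ C, proj p U c = proj p U x) : x ∈ C := by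
  have hne := IsCompact.nonempty_iInter_of_directed_nonempty_isCompact_isClosed
    (fun U : OpenSubgroup G => C ∩ {c | proj p U c = proj p U x})
    (by
      intro U V
      refine ⟨U ⊓ V, ?_, ?_⟩
      · exact fun c hc => ⟨hc.1, proj_eq_of_le inf_le_left hc.2⟩
      · exact fun c hc => ⟨hc.1, proj_eq_of_le inf_le_right hc.2⟩)
    (fun U => h U)
    (fun U => (hC.inter (isClosed_setOf_proj_eq p U x)).isCompact)
    (fun U => hC.inter (isClosed_setOf_proj_eq p U x))
  obtain ⟨c, hc⟩ := hne
  rw [Set.mem_iInter] at hc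
  rw [← proj_ext fun U => (hc U).2]
  exact (hc ⊤).1

theorem isOpen_levelIdeal (U : OpenSubgroup G) (n : ℕ) :
    IsOpen (levelIdeal p U n : Set (CompletedGroupAlgebra p G)) := by
  have : (levelIdeal p U n : Set (CompletedGroupAlgebra p G)) =
      ⋂ g, {c | (proj p U c).coeff g ∈ Metric.closedBall (0 : ℤ_[p]) ((p : ℝ) ^ (-n : ℤ))} := by
    ext c
    simp only [Set.mem_ofPred_eq, Set.mem_iInter, SetLike.mem_coe, mem_levelIdeal,
      mem_closedBall_zero_iff, PadicInt.norm_le_pow_iff_mem_span_pow, Ideal.mem_span_singleton]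
    rw [← algebraMap_dvd_monoidAlgebra_iff, map_pow, map_natCast]
  rw [this]
  refine isOpen_iInter_of_finite fun g => ?_
  refine (IsUltrametricDist.isOpen_closedBall _ ?_).preimage (continuous_coeff_proj p U g)
  have := (Fact.out : p.Prime).pos
  positivity

theorem isClosed_levelIdeal (U : OpenSubgroup G) (n : ℕ) :
    IsClosed (levelIdeal p U n : Set (CompletedGroupAlgebra p G)) :=
  AddSubgroup.isClosed_of_isOpen (levelIdeal p U n).toAddSubgroup (isOpen_levelIdeal U n)

theorem iInter_levelIdeal :
    ⋂ i : (OpenSubgroup G)ᵒᵈ × ℕ, (levelIdeal p (OrderDual.ofDual i.1) i.2 :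
      Set (CompletedGroupAlgebra p G)) = {0} := by
  refine Set.eq_singleton_iff_unique_mem.2 ⟨?_, fun x hx => ?_⟩
  · simp
  rw [Set.mem_iInter] at hx
  refine coeffs_injective p G (funext fun U => funext fun g => ?_)
  change (proj p U x).coeff g = (proj p U 0).coeff g
  rw [map_zero, MonoidAlgebra.coeff_zero, Finsupp.zero_apply]
  have hd : ∀ n : ℕ, (p : ℤ_[p]) ^ n ∣ (proj p U x).coeff g := fun n => by
    have : (p : MonoidAlgebra ℤ_[p] (G ⧸ (U : Subgroup G))) ^ n ∣ proj p U x :=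
      mem_levelIdeal.1 (hx (OrderDual.toDual U, n))
    rw [show (p : MonoidAlgebra ℤ_[p] (G ⧸ (U : Subgroup G))) ^ n =
      algebraMap ℤ_[p] _ ((p : ℤ_[p]) ^ n) by rw [map_pow, map_natCast],
      algebraMap_dvd_monoidAlgebra_iff] at this
    exact this g
  by_contra hne
  have := FiniteMultiplicity.of_prime_left (PadicInt.prime_p (p := p)) hne
  exact this.not_pow_dvd_of_multiplicity_lt (Nat.lt_succ_self _) (hd _)

/-- The level ideals form a directed family of compact sets with intersection {0}, so one of them
lies in any given neighbourhood of 0. -/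
theorem exists_levelIdeal_subset {W : Set (CompletedGroupAlgebra p G)} (hW : W ∈ 𝓝 0) :
    ∃ (U : OpenSubgroup G) (n : ℕ), (levelIdeal p U n : Set (CompletedGroupAlgebra p G)) ⊆ W := by
  obtain ⟨i, hi⟩ := exists_subset_nhds_of_isCompact'
    (V := fun i : (OpenSubgroup G)ᵒᵈ × ℕ => (levelIdeal p (OrderDual.ofDual i.1) i.2 :
      Set (CompletedGroupAlgebra p G)))
    (levelIdeal_antitone p).directed_ge
    (fun i => (isClosed_levelIdeal _ _).isCompact) (fun i => isClosed_levelIdeal _ _)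
    (U := W) (by
      intro x hx
      rw [iInter_levelIdeal, Set.mem_singleton_iff] at hx
      rwa [hx])
  exact ⟨_, _, hi⟩

instance : IsLinearTopology (CompletedGroupAlgebra p G) (CompletedGroupAlgebra p G) :=
  IsLinearTopology.mk_of_hasBasis' (CompletedGroupAlgebra p G)
    (S := Ideal (CompletedGroupAlgebra p G)) (p := fun _ : (OpenSubgroup G) × ℕ => True)
    (s := fun i => levelIdeal p i.1 i.2)
    ⟨fun W => ⟨fun hW => by
      obtain ⟨U, n, h⟩ := exists_levelIdeal_subset hW
      exact ⟨(U, n), trivial, h⟩, fun ⟨i, _, h⟩ => Filter.mem_of_superset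
        ((isOpen_levelIdeal i.1 i.2).mem_nhds (zero_mem _)) h⟩⟩
    (fun I r m hm => I.mul_mem_left r hm)

theorem isClosed_of_fg {I : Ideal (CompletedGroupAlgebra p G)} (hI : I.FG) :
    IsClosed (I : Set (CompletedGroupAlgebra p G)) :=
  (isCompact_of_fg hI).isClosed

end Topology

/-- Modulo p, (1 + t) ^ p ^ b = 1 + t ^ p ^ b = 1. Each further p-th power improves this congruence
to 1 by a factor of p, until p ^ a = 0. -/
theorem exists_one_add_pow_prime_pow_eq_one {Q : Type*} [CommRing Q] {p : ℕ} (hp : p.Prime)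
    {t : Q} {a b : ℕ} (ha : (p : Q) ^ a = 0) (hb : t ^ b = 0) :
    ∃ N, ∀ n, N ≤ n → (1 + t) ^ p ^ n = 1 := by
  have hbp : t ^ p ^ b = 0 := pow_eq_zero_of_le (Nat.lt_pow_self hp.one_lt).le hb
  obtain ⟨r, hr⟩ := exists_add_pow_prime_pow_eq hp (1 : Q) t b
  have hd : (p : Q) ∣ (1 + t) ^ p ^ b - 1 := ⟨t * r, by rw [hr, hbp]; ring⟩
  obtain ⟨y, hy⟩ := dvd_sub_pow_of_dvd_sub hd a
  rw [pow_succ, ha, zero_mul, zero_mul, one_pow, ← pow_mul, ← pow_add, sub_eq_zero] at hy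
  refine ⟨b + a, fun n hn => ?_⟩
  obtain ⟨k, rfl⟩ := Nat.exists_eq_add_of_le hn
  rw [pow_add, pow_mul, hy, one_pow]

theorem isNilpotent_of_one_add_pow_prime_pow_eq_one {Q : Type*} [CommRing Q] {p : ℕ}
    (hp : p.Prime) {t : Q} {a n : ℕ} (ha : (p : Q) ^ a = 0) (ht : (1 + t) ^ p ^ n = 1) :
    ∃ N, t ^ N = 0 := by
  obtain ⟨r, hr⟩ := exists_add_pow_prime_pow_eq hp (1 : Q) t n
  rw [ht, one_pow] at hr
  refine ⟨p ^ n * a, ?_⟩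
  have : t ^ p ^ n = p * (-(t * r)) := by linear_combination -hr
  rw [pow_mul, this, mul_pow, ha, zero_mul]

instance PadicInt.isLinearTopology (p : ℕ) [Fact p.Prime] : IsLinearTopology ℤ_[p] ℤ_[p] := by
  refine IsLinearTopology.mk_of_hasBasis (R := ℤ_[p]) (p := fun _ : ℕ => True)
    (s := fun n => Ideal.span {(p : ℤ_[p]) ^ n}) ?_
  have hp : (1 : ℝ) < p := by exact_mod_cast (Fact.out : p.Prime).one_lt
  convert! Metric.nhds_basis_closedBall_pow (x := (0 : ℤ_[p])) (inv_pos.2 (zero_lt_one.trans hp))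
    (inv_lt_one_of_one_lt₀ hp) using 2 with n
  ext x
  rw [SetLike.mem_coe, ← PadicInt.norm_le_pow_iff_mem_span_pow, mem_closedBall_zero_iff, zpow_neg,
    zpow_natCast, inv_pow]

theorem PadicInt.tendsto_pow_zero (p : ℕ) [Fact p.Prime] :
    Tendsto (fun n : ℕ => (p : ℤ_[p]) ^ n) atTop (𝓝 0) :=
  tendsto_pow_atTop_nhds_zero_of_norm_lt_one (by
    rw [PadicInt.norm_p]
    exact inv_lt_one_of_one_lt₀ (by exact_mod_cast (Fact.out : p.Prime).one_lt))

/-! ### The isomorphism of ℤ_p⟦G⟧ with a power series ring -/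

section Generators

variable {p : ℕ} [Fact p.Prime] {d : ℕ} {G : Type u} [CommGroup G] [TopologicalSpace G]

/-- The topological generators of `G` given by an isomorphism `G ≃ ℤ_p ^ d`. -/
noncomputable def gen (e : G ≃ₜ* Multiplicative (Fin d → ℤ_[p])) (i : Fin d) : G :=
  e.symm (Multiplicative.ofAdd (Pi.single i 1))

theorem compactSpace_of_equiv (e : G ≃ₜ* Multiplicative (Fin d → ℤ_[p])) : CompactSpace G :=
  have : CompactSpace (Multiplicative (Fin d → ℤ_[p])) :=
    inferInstanceAs (CompactSpace (Fin d → ℤ_[p]))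
  e.toHomeomorph.symm.compactSpace

theorem tendsto_pow_prime_pow (e : G ≃ₜ* Multiplicative (Fin d → ℤ_[p])) (g : G) :
    Tendsto (fun n : ℕ => g ^ p ^ n) atTop (𝓝 1) := by
  have h1 : Tendsto (fun n : ℕ => Multiplicative.ofAdd ((p : ℤ_[p]) ^ n • (e g).toAdd)) atTop
      (𝓝 (Multiplicative.ofAdd (0 : Fin d → ℤ_[p]))) := by
    have := (PadicInt.tendsto_pow_zero p).smul_const (e g).toAdd
    rw [zero_smul] at this
    exact this
  have hc : Continuous e.symm := e.symm.continuous
  have h2 := (hc.tendsto (Multiplicative.ofAdd (0 : Fin d → ℤ_[p]))).comp h1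
  rw [ofAdd_zero, map_one] at h2
  refine h2.congr fun n => ?_
  have : Multiplicative.ofAdd ((p : ℤ_[p]) ^ n • (e g).toAdd) = e g ^ p ^ n := by
    apply Multiplicative.toAdd.injective
    rw [toAdd_pow, toAdd_ofAdd, ← Nat.cast_pow, Nat.cast_smul_eq_nsmul]
  simp only [Function.comp_apply]
  rw [this, map_pow]
  simp

theorem denseRange_prod_gen (e : G ≃ₜ* Multiplicative (Fin d → ℤ_[p])) :
    DenseRange fun n : Fin d → ℕ => ∏ i, gen e i ^ n i := by
  have h1 : DenseRange (Pi.map fun _ : Fin d => (Nat.cast : ℕ → ℤ_[p])) :=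
    DenseRange.piMap fun _ => PadicInt.denseRange_natCast
  have h2 := (e.symm.toHomeomorph.surjective.denseRange).comp
    (g := e.symm) (f := fun n => Multiplicative.ofAdd (Pi.map (fun _ : Fin d =>
      (Nat.cast : ℕ → ℤ_[p])) n)) h1 e.symm.continuous
  convert h2 using 2 with n
  simp only [Function.comp_apply, gen, ← map_pow, ← map_prod]
  congr 1
  apply Multiplicative.toAdd.injective
  ext j
  simp [toAdd_prod, Finset.sum_apply, Pi.single_apply]

variable [IsTopologicalGroup G]

/-- Modulo a level ideal, p is nilpotent and g has p-power order because g ^ p ^ m tends to 1; hence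
g - 1 is nilpotent there. -/
theorem isTopologicallyNilpotent_grp_sub_one (e : G ≃ₜ* Multiplicative (Fin d → ℤ_[p])) (g : G) :
    IsTopologicallyNilpotent (grp p G g - 1) := by
  have := compactSpace_of_equiv e
  rw [IsTopologicallyNilpotent, IsLinearTopology.hasBasis_ideal.tendsto_right_iff]
  intro W hW
  obtain ⟨U, n, hUn⟩ := exists_levelIdeal_subset hW
  obtain ⟨m, hm⟩ := ((tendsto_pow_prime_pow e g).eventually (U.mem_nhds_one)).exists
  have hpow : (p : CompletedGroupAlgebra p G ⧸ levelIdeal p U n) ^ n = 0 := by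
    rw [← map_natCast (Ideal.Quotient.mk (levelIdeal p U n)), ← map_pow]
    exact Ideal.Quotient.eq_zero_iff_mem.2 (pow_mem_levelIdeal p U n)
  obtain ⟨N, hN⟩ := isNilpotent_of_one_add_pow_prime_pow_eq_one (Fact.out : p.Prime)
    (t := Ideal.Quotient.mk (levelIdeal p U n) (grp p G g - 1)) (n := m) hpow (by
      rw [← map_one (Ideal.Quotient.mk (levelIdeal p U n)), ← map_add, add_sub_cancel, ← map_pow,
        ← map_pow, ← sub_eq_zero, ← map_sub, Ideal.Quotient.eq_zero_iff_mem]
      exact kerProj_le_levelIdeal p U n (grp_sub_one_mem_kerProj p hm))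
  filter_upwards [eventually_ge_atTop N] with k hk
  refine hUn (Ideal.Quotient.eq_zero_iff_mem.1 ?_)
  rw [map_pow]
  exact pow_eq_zero_of_le hk hN

theorem continuous_grp [CompactSpace G] : Continuous (grp p G) := by
  refine (continuous_iff_coeff_proj p G).2 fun U g => ?_
  have : DiscreteTopology (G ⧸ (U : Subgroup G)) := QuotientGroup.discreteTopology U.isOpen
  exact (continuous_of_discreteTopology (f := fun h : G ⧸ (U : Subgroup G) =>
    (MonoidAlgebra.of ℤ_[p] (G ⧸ (U : Subgroup G)) h).coeff g)).comp continuous_quotient_mk'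

open MvPowerSeries.WithPiTopology

/-- The uniform structure of the compact ring `ℤ_p⟦G⟧`. -/
noncomputable abbrev uniformSpace [CompactSpace G] : UniformSpace (CompletedGroupAlgebra p G) :=
  IsTopologicalAddGroup.rightUniformSpace _

theorem hasEval_gen (e : G ≃ₜ* Multiplicative (Fin d → ℤ_[p])) :
    MvPowerSeries.HasEval fun i => grp p G (gen e i) - 1 where
  hpow i := isTopologicallyNilpotent_grp_sub_one e _
  tendsto_zero := by simp [Filter.cofinite_eq_bot]

/-- The map `ℤ_p⟦T₁, …, T_d⟧ → ℤ_p⟦G⟧` sending `T_i` to `γ_i - 1`. -/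
noncomputable def ofPowerSeries [CompactSpace G] (e : G ≃ₜ* Multiplicative (Fin d → ℤ_[p])) :
    MvPowerSeries (Fin d) ℤ_[p] →ₐ[ℤ_[p]] CompletedGroupAlgebra p G :=
  letI := uniformSpace (p := p) (G := G)
  have : IsUniformAddGroup (CompletedGroupAlgebra p G) := isUniformAddGroup_of_addCommGroup
  MvPowerSeries.aeval (hasEval_gen e)

variable [CompactSpace G] (e : G ≃ₜ* Multiplicative (Fin d → ℤ_[p]))

theorem continuous_ofPowerSeries : Continuous (ofPowerSeries e) :=
  letI := uniformSpace (p := p) (G := G)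
  have : IsUniformAddGroup (CompletedGroupAlgebra p G) := isUniformAddGroup_of_addCommGroup
  MvPowerSeries.continuous_aeval (hasEval_gen e)

theorem ofPowerSeries_coe (f : MvPolynomial (Fin d) ℤ_[p]) :
    ofPowerSeries e f = MvPolynomial.aeval (fun i => grp p G (gen e i) - 1) f :=
  letI := uniformSpace (p := p) (G := G)
  have : IsUniformAddGroup (CompletedGroupAlgebra p G) := isUniformAddGroup_of_addCommGroup
  MvPowerSeries.aeval_coe (hasEval_gen e) f

theorem ofPowerSeries_X (i : Fin d) :
    ofPowerSeries e (MvPowerSeries.X i) = grp p G (gen e i) - 1 := by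
  rw [← MvPolynomial.coe_X, ofPowerSeries_coe, MvPolynomial.aeval_X]

/-- The image is compact, hence closed. It contains the monomials in the γ_i, which are dense in G,
hence all of G, so it maps onto every ℤ_p[G/U]. -/
theorem ofPowerSeries_surjective : Function.Surjective (ofPowerSeries e) := by
  have hcpt : CompactSpace (MvPowerSeries (Fin d) ℤ_[p]) :=
    inferInstanceAs (CompactSpace ((Fin d →₀ ℕ) → ℤ_[p]))
  have hcl : IsClosed ((ofPowerSeries e).range : Set (CompletedGroupAlgebra p G)) := by
    rw [AlgHom.coe_range]
    exact (isCompact_range (continuous_ofPowerSeries e)).isClosed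
  have hg : ∀ g, grp p G g ∈ (ofPowerSeries e).range := by
    intro g
    refine (denseRange_prod_gen e).induction_on
      (p := fun g => grp p G g ∈ (ofPowerSeries e).range) g (hcl.preimage continuous_grp)
      fun n => ?_
    rw [map_prod]
    refine prod_mem fun i _ => ?_
    rw [map_pow]
    refine pow_mem ?_ _
    rw [← sub_add_cancel (grp p G (gen e i)) 1, ← ofPowerSeries_X]
    exact add_mem (AlgHom.mem_range_self _ _) (one_mem _)
  intro x
  refine mem_of_isClosed_of_forall_proj
    (C := ((ofPowerSeries e).range : Set (CompletedGroupAlgebra p G))) hcl fun U => ?_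
  suffices ∀ y, ∃ c ∈ (ofPowerSeries e).range, proj p U c = y from this _
  intro y
  induction y using MonoidAlgebra.induction_linear with
  | zero => exact ⟨0, zero_mem _, map_zero _⟩
  | add x y hx hy =>
    obtain ⟨a, ha, rfl⟩ := hx
    obtain ⟨b, hb, rfl⟩ := hy
    exact ⟨a + b, add_mem ha hb, map_add _ _ _⟩
  | single m r =>
    obtain ⟨g, rfl⟩ := QuotientGroup.mk_surjective m
    refine ⟨r • grp p G g, Subalgebra.smul_mem _ (hg g) r, ?_⟩
    rw [map_smul, proj_grp, MonoidAlgebra.of_apply, MonoidAlgebra.smul_single, smul_eq_mul, mul_one]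

/-- If the elements `u_i` of a `ℤ_p`-algebra `Q` in which `p` is nilpotent have `p`-power order,
then `γ_i ↦ u_i` extends to `ℤ_p⟦G⟧ → Q` with open kernel. -/
theorem exists_algHom_of_pow_eq_one {Q : Type*} [CommRing Q] [Algebra ℤ_[p] Q] {a : ℕ}
    (ha : (p : Q) ^ a = 0) (w : Fin d → Q) {n : ℕ} (hw : ∀ i, w i ^ p ^ n = 1) :
    ∃ ψ : CompletedGroupAlgebra p G →ₐ[ℤ_[p]] Q, (∀ i, ψ (grp p G (gen e i)) = w i) ∧
      IsOpen (RingHom.ker ψ : Set (CompletedGroupAlgebra p G)) := by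
  let κ : G →* Multiplicative (Fin d → ZMod (p ^ n)) :=
    (AddMonoidHom.toMultiplicative
      (AddMonoidHom.compLeft (PadicInt.toZModPow (p := p) n).toAddMonoidHom (Fin d))).comp
      e.toMulEquiv.toMonoidHom
  -- G/V embeds in (ℤ/p^n)^d through κ, and γ_i ↦ w i is a well-defined homomorphism on (ℤ/p^n)^d
  -- because w i ^ p ^ n = 1.
  have hκ : ∀ g i, (κ g).toAdd i = PadicInt.toZModPow n ((e g).toAdd i) := fun _ _ => rfl
  let V : OpenSubgroup G := ⟨κ.ker, by
    have : (κ.ker : Set G) = ⋂ i, {g | (e g).toAdd i ∈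
        Metric.closedBall (0 : ℤ_[p]) ((p : ℝ) ^ (-n : ℤ))} := by
      ext g
      simp only [Set.mem_ofPred_eq, Set.mem_iInter, SetLike.mem_coe, MonoidHom.mem_ker,
        mem_closedBall_zero_iff, PadicInt.norm_le_pow_iff_mem_span_pow, ← PadicInt.ker_toZModPow,
        RingHom.mem_ker, ← hκ]
      exact ⟨fun h i => by rw [h]; rfl, fun h => Multiplicative.toAdd.injective (funext h)⟩
    change IsOpen (κ.ker : Set G)
    rw [this]
    refine isOpen_iInter_of_finite fun i => ?_
    refine (IsUltrametricDist.isOpen_closedBall _ ?_).preimage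
      ((continuous_apply i).comp (continuous_toAdd.comp e.continuous))
    have := (Fact.out : p.Prime).pos
    positivity⟩
  let χ' : Multiplicative (Fin d → ZMod (p ^ n)) →* Q :=
    { toFun := fun x => ∏ i, w i ^ (x.toAdd i).val
      map_one' := by simp
      map_mul' := fun x y => by
        rw [← Finset.prod_mul_distrib]
        refine Finset.prod_congr rfl fun i _ => ?_
        rw [toAdd_mul, Pi.add_apply, ZMod.val_add, ← pow_eq_pow_mod _ (hw i), pow_add] }
  let χ : G ⧸ (V : Subgroup G) →* Q := QuotientGroup.lift (V : Subgroup G) (χ'.comp κ)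
    (fun g hg => by
      have : κ g = 1 := hg
      rw [MonoidHom.mem_ker, MonoidHom.comp_apply, this, map_one])
  refine ⟨(MonoidAlgebra.lift ℤ_[p] Q _ χ).comp (proj p V), fun i => ?_, ?_⟩
  · rw [AlgHom.comp_apply, proj_grp, MonoidAlgebra.lift_of]
    change ∏ j, w j ^ ((κ (gen e i)).toAdd j).val = w i
    have hgen : (e (gen e i)).toAdd = Pi.single i 1 := by simp [gen]
    rw [Finset.prod_eq_single i]
    · rw [hκ, hgen, Pi.single_eq_same, map_one, ZMod.val_one_eq_one_mod, ← pow_eq_pow_mod _ (hw i),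
        pow_one]
    · intro j _ hj
      rw [hκ, hgen, Pi.single_eq_of_ne hj, map_zero, ZMod.val_zero, pow_zero]
    · simp
  · refine AddSubgroup.isOpen_mono (H₁ := (levelIdeal p V a).toAddSubgroup)
      (H₂ := (RingHom.ker ((MonoidAlgebra.lift ℤ_[p] Q _ χ).comp (proj p V))).toAddSubgroup) ?_
      (isOpen_levelIdeal V a)
    intro x hx
    obtain ⟨y, hy⟩ := mem_levelIdeal.1 hx
    change ((MonoidAlgebra.lift ℤ_[p] Q _ χ).comp (proj p V)) x = 0
    rw [AlgHom.comp_apply, hy, map_mul, map_pow, map_natCast, ha, zero_mul]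

/-- An element f of the kernel lies in every open ideal I. Modulo I both p and the T_i are
nilpotent, so the 1 + T_i have p-power order and γ_i ↦ 1 + T_i extends to ℤ_p⟦G⟧. The resulting
composite agrees with the quotient map, which therefore kills f. -/
theorem ofPowerSeries_injective : Function.Injective (ofPowerSeries e) := by
  rw [injective_iff_map_eq_zero]
  intro f hf
  have hT2 : T2Space (MvPowerSeries (Fin d) ℤ_[p]) := inferInstance
  suffices ∀ I : Ideal (MvPowerSeries (Fin d) ℤ_[p]),
      IsOpen (I : Set (MvPowerSeries (Fin d) ℤ_[p])) → f ∈ I by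
    by_contra hne
    obtain ⟨I, hI, hfI⟩ := (IsLinearTopology.hasBasis_open_ideal
      (R := MvPowerSeries (Fin d) ℤ_[p])).mem_iff.1 (compl_singleton_mem_nhds (Ne.symm hne))
    exact hfI (this I hI) rfl
  intro I hI
  have hI0 : (I : Set (MvPowerSeries (Fin d) ℤ_[p])) ∈ 𝓝 0 := hI.mem_nhds (zero_mem _)
  obtain ⟨a, ha⟩ : ∃ a : ℕ, (p : MvPowerSeries (Fin d) ℤ_[p]) ^ a ∈ I := by
    have h1 : Tendsto (fun n : ℕ => MvPowerSeries.C (σ := Fin d) ((p : ℤ_[p]) ^ n)) atTop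
        (𝓝 (MvPowerSeries.C 0)) :=
      (MvPowerSeries.WithPiTopology.continuous_C.tendsto _).comp (PadicInt.tendsto_pow_zero p)
    rw [map_zero] at h1
    obtain ⟨a, ha⟩ := (h1.eventually hI0).exists
    refine ⟨a, ?_⟩
    rw [← map_natCast (MvPowerSeries.C (σ := Fin d) (R := ℤ_[p])), ← map_pow]
    exact ha
  have hX : ∀ i : Fin d, ∃ b : ℕ, (MvPowerSeries.X i : MvPowerSeries (Fin d) ℤ_[p]) ^ b ∈ I :=
    fun i => ((MvPowerSeries.HasEval.X.hpow i).eventually hI0).exists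
  choose b hb using hX
  have ha' : (p : MvPowerSeries (Fin d) ℤ_[p] ⧸ I) ^ a = 0 := by
    rw [← map_natCast (Ideal.Quotient.mk I), ← map_pow]
    exact Ideal.Quotient.eq_zero_iff_mem.2 ha
  have hN : ∀ i : Fin d, ∃ N, ∀ n, N ≤ n →
      (1 + Ideal.Quotient.mk I (MvPowerSeries.X i)) ^ p ^ n = 1 := fun i =>
    exists_one_add_pow_prime_pow_eq_one (Fact.out : p.Prime) ha' (b := b i) (by
      rw [← map_pow]
      exact Ideal.Quotient.eq_zero_iff_mem.2 (hb i))
  choose N hN using hN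
  obtain ⟨ψ, hψ, hker⟩ := exists_algHom_of_pow_eq_one e ha'
    (fun i => 1 + Ideal.Quotient.mk I (MvPowerSeries.X i)) (n := Finset.univ.sup N)
    (fun i => hN i _ (Finset.le_sup (Finset.mem_univ i)))
  -- L is where the two maps agree. It is open because both vanish on an open subgroup, hence it is
  -- closed, and it contains the dense subring of polynomials.
  let L : AddSubgroup (MvPowerSeries (Fin d) ℤ_[p]) :=
    (AlgHom.equalizer (ψ.comp (ofPowerSeries e))
      (Ideal.Quotient.mkₐ ℤ_[p] I)).toSubring.toAddSubgroup
  have hL : ∀ g, g ∈ L ↔ ψ (ofPowerSeries e g) = Ideal.Quotient.mk I g := fun _ => Iff.rfl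
  have hLo : IsOpen (L : Set (MvPowerSeries (Fin d) ℤ_[p])) := by
    refine AddSubgroup.isOpen_mono
      (H₁ := ((RingHom.ker ψ).comap (ofPowerSeries e) ⊓ I).toAddSubgroup) ?_
      ((hker.preimage (continuous_ofPowerSeries e)).inter hI)
    rintro g ⟨hg1, hg2⟩
    rw [hL, Ideal.Quotient.eq_zero_iff_mem.2 hg2]
    exact hg1
  have hLc := L.isClosed_of_isOpen hLo
  have hfL : f ∈ L := by
    refine MvPowerSeries.WithPiTopology.denseRange_toMvPowerSeries.induction_on
      (p := fun f => f ∈ L) f hLc fun g => ?_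
    rw [hL, ofPowerSeries_coe]
    induction g using MvPolynomial.induction_on with
    | C r =>
      rw [MvPolynomial.aeval_C, AlgHom.commutes, MvPolynomial.coe_C]
      rfl
    | add x y hx hy => simp only [map_add, hx, hy, MvPolynomial.coe_add]
    | mul_X x i hx =>
      simp only [map_mul, hx, MvPolynomial.coe_mul, MvPolynomial.aeval_X, map_sub, hψ, map_one,
        MvPolynomial.coe_X, add_sub_cancel_left]
  rw [hL, hf, map_zero] at hfL
  exact Ideal.Quotient.eq_zero_iff_mem.1 hfL.symm

/-- The isomorphism `ℤ_p⟦T₁, …, T_d⟧ ≃ ℤ_p⟦G⟧`. -/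
noncomputable def powerSeriesEquiv :
    MvPowerSeries (Fin d) ℤ_[p] ≃+* CompletedGroupAlgebra p G :=
  RingEquiv.ofBijective (ofPowerSeries e) ⟨ofPowerSeries_injective e, ofPowerSeries_surjective e⟩

theorem isNoetherianRing_of_equiv (e : G ≃ₜ* Multiplicative (Fin d → ℤ_[p])) :
    IsNoetherianRing (CompletedGroupAlgebra p G) :=
  isNoetherianRing_of_ringEquiv _ (powerSeriesEquiv e)

theorem isDomain_of_equiv (e : G ≃ₜ* Multiplicative (Fin d → ℤ_[p])) :
    IsDomain (CompletedGroupAlgebra p G) :=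
  have : IsDomain (MvPowerSeries (Fin d) ℤ_[p]) := NoZeroDivisors.to_isDomain _
  (powerSeriesEquiv e).symm.toMulEquiv.isDomain _

theorem isCompletelyIntegrallyClosed_of_equiv (e : G ≃ₜ* Multiplicative (Fin d → ℤ_[p])) :
    IsCompletelyIntegrallyClosed (CompletedGroupAlgebra p G) :=
  ((IsCompletelyIntegrallyClosed.of_isIntegrallyClosed ℤ_[p]).mvPowerSeries d).of_ringEquiv
    (powerSeriesEquiv e)

end Generators

/-! ### Augmentation ideals, norm elements and duality at finite level -/

section Ideals

variable (p : ℕ) [Fact p.Prime] {G : Type u} [CommGroup G] [TopologicalSpace G]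

/-- The ideal of `ℤ_p⟦G⟧` generated by the elements `u - 1` with `u ∈ U`. -/
noncomputable def augIdeal (U : OpenSubgroup G) : Ideal (CompletedGroupAlgebra p G) :=
  Ideal.span {x | ∃ u ∈ U, x = grp p G u - 1}

theorem augIdeal_le_kerProj (U : OpenSubgroup G) : augIdeal p U ≤ kerProj p U := by
  rw [augIdeal, Ideal.span_le]
  rintro _ ⟨u, hu, rfl⟩
  exact grp_sub_one_mem_kerProj p hu

/-- Replacing each group element by the chosen representative of its U-coset changes it by an
element of the augmentation ideal. -/
theorem exists_mem_augIdeal_proj_eq {V U : OpenSubgroup G} (h : V ≤ U)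
    (y : MonoidAlgebra ℤ_[p] (G ⧸ (V : Subgroup G))) :
    ∃ c ∈ augIdeal p U, proj p V c = y - MonoidAlgebra.mapDomain
      (fun b : G ⧸ (U : Subgroup G) => (b.out : G ⧸ (V : Subgroup G))) (transition p G h y) := by
  induction y using MonoidAlgebra.induction_linear with
  | zero => exact ⟨0, zero_mem _, by simp⟩
  | add x y hx hy =>
    obtain ⟨a, ha, hax⟩ := hx
    obtain ⟨b, hb, hby⟩ := hy
    refine ⟨a + b, add_mem ha hb, ?_⟩
    rw [map_add, map_add, MonoidAlgebra.mapDomain_add, hax, hby]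
    abel
  | single m r =>
    obtain ⟨g, rfl⟩ := QuotientGroup.mk_surjective m
    obtain ⟨u, hu⟩ := QuotientGroup.mk_out_eq_mul (U : Subgroup G) g
    refine ⟨r • (grp p G g - grp p G (g * u)), ?_, ?_⟩
    · refine Submodule.smul_of_tower_mem _ r ?_
      have : grp p G g - grp p G (g * u) = -grp p G g * (grp p G u - 1) := by
        rw [map_mul]; ring
      rw [this]
      exact Ideal.mul_mem_left _ _ (Ideal.subset_span ⟨u, u.2, rfl⟩)
    · have ht : transition p G h (MonoidAlgebra.single (g : G ⧸ (V : Subgroup G)) r) =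
          MonoidAlgebra.single (g : G ⧸ (U : Subgroup G)) r := by
        simp only [transition, MonoidAlgebra.mapDomainAlgHom_apply, MonoidAlgebra.mapDomain_single]
        rfl
      rw [ht, MonoidAlgebra.mapDomain_single, hu, map_smul, map_sub, proj_grp, proj_grp, smul_sub,
        MonoidAlgebra.of_apply, MonoidAlgebra.of_apply, MonoidAlgebra.smul_single,
        MonoidAlgebra.smul_single, smul_eq_mul, mul_one]

variable {p} in
theorem mem_kerProj_of_pow_mul_mem {U : OpenSubgroup G} {n : ℕ} {x : CompletedGroupAlgebra p G}
    (h : (p : CompletedGroupAlgebra p G) ^ n * x ∈ kerProj p U) : x ∈ kerProj p U := by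
  rw [mem_kerProj] at h ⊢
  have h' : ((p : ℤ_[p]) ^ n) • proj p U x = 0 := by
    rw [Algebra.smul_def, map_pow, map_natCast, ← h, map_mul, map_pow, map_natCast]
  ext g
  have := congrArg (fun z => MonoidAlgebra.coeff z g) h'
  simp only [MonoidAlgebra.coeff_smul_apply, smul_eq_mul, MonoidAlgebra.coeff_zero,
    Finsupp.zero_apply, mul_eq_zero] at this
  exact this.resolve_left (pow_ne_zero _ (PadicInt.prime_p.ne_zero))

variable {p} in
-- ℤ_p[G/U] has no p-torsion and f acts on it as p ^ n.
theorem mem_kerProj_of_mul_mem {U : OpenSubgroup G} {n : ℕ} {f x : CompletedGroupAlgebra p G}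
    (hf : f - (p : CompletedGroupAlgebra p G) ^ n ∈ kerProj p U) (h : f * x ∈ kerProj p U) :
    x ∈ kerProj p U := by
  refine mem_kerProj_of_pow_mul_mem (n := n) ?_
  have : (p : CompletedGroupAlgebra p G) ^ n * x =
      f * x - (f - (p : CompletedGroupAlgebra p G) ^ n) * x := by ring
  rw [this]
  exact sub_mem h (Ideal.mul_mem_right _ _ hf)

variable {p} in
theorem ne_zero_of_sub_pow_mem_kerProj {U : OpenSubgroup G} {n : ℕ} {f : CompletedGroupAlgebra p G}
    (hf : f - (p : CompletedGroupAlgebra p G) ^ n ∈ kerProj p U) : f ≠ 0 := by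
  rintro rfl
  have h1 := mem_kerProj.1 (mem_kerProj_of_mul_mem (x := 1) hf (by simp))
  rw [map_one] at h1
  exact one_ne_zero h1

variable (G) in
/-- A lift to `ℤ_p⟦G⟧` of the element `∑_{τ ∈ U/V} τ` of `ℤ_p[G/V]`. -/
noncomputable def normElt (U V : OpenSubgroup G) : CompletedGroupAlgebra p G :=
  ∑ᶠ τ : relQuotient G U V, grp p G (τ : G ⧸ (V : Subgroup G)).out

variable [IsTopologicalGroup G] [CompactSpace G]

theorem kerProj_eq_augIdeal [IsNoetherianRing (CompletedGroupAlgebra p G)] (U : OpenSubgroup G) :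
    kerProj p U = augIdeal p U := by
  refine le_antisymm (fun x hx => ?_) (augIdeal_le_kerProj p U)
  refine mem_of_isClosed_of_forall_proj (isClosed_of_fg (IsNoetherian.noetherian (augIdeal p U)))
    fun W => ?_
  obtain ⟨c, hc, hcx⟩ := exists_mem_augIdeal_proj_eq p (V := W ⊓ U) (U := U) inf_le_right
    (proj p (W ⊓ U) x)
  refine ⟨c, hc, proj_eq_of_le (V := W ⊓ U) inf_le_left ?_⟩
  rw [hcx, transition_proj, mem_kerProj.1 hx, MonoidAlgebra.mapDomain_zero, sub_zero]

/-- Viewing group ring elements as functions, multiplication by the norm element is pullback of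
functions along G/V → G/U: each coefficient is a sum over a U/V-coset. This pullback is injective,
and its image consists of the U-invariant functions. -/
theorem coeff_normElt_mul {V U : OpenSubgroup G} (h : V ≤ U) (x : CompletedGroupAlgebra p G)
    (g : G) : (proj p V (normElt p G U V * x)).coeff g = (proj p U x).coeff g := by
  have := Fintype.ofFinite (relQuotient G U V)
  rw [← transition_proj p h, coeff_transition, normElt, finsum_eq_sum_of_fintype, Finset.sum_mul,
    map_sum, MonoidAlgebra.coeff_sum, Finsupp.finsetSum_apply]
  have hterm : ∀ τ : relQuotient G U V,
      (proj p V (grp p G (τ : G ⧸ (V : Subgroup G)).out * x)).coeff g =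
        (proj p V x).coeff ((τ : G ⧸ (V : Subgroup G))⁻¹ * g) := by
    intro τ
    rw [map_mul, proj_grp, QuotientGroup.out_eq', coeff_of_mul]
  simp_rw [hterm]
  rw [← finsum_eq_sum_of_fintype]
  refine (finsum_set_coe_eq_finsum_mem (relQuotient G U V : Set (G ⧸ (V : Subgroup G)))
    (f := fun τ => (proj p V x).coeff (τ⁻¹ * g))).trans ?_
  have hrel : ∀ τ : G ⧸ (V : Subgroup G), τ ∈ relQuotient G U V ↔ levelMap h τ = 1 := by
    intro τ
    obtain ⟨t, rfl⟩ := QuotientGroup.mk_surjective τ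
    rw [levelMap_mk, QuotientGroup.eq_one_iff]
    constructor
    · rintro ⟨s, hs, hst⟩
      have := h (QuotientGroup.eq.1 hst)
      simpa using U.mul_mem hs this
    · exact fun ht => ⟨t, ht, rfl⟩
  -- The map τ ↦ τ⁻¹ g is a bijection from U/V onto the fibre of G/V → G/U through g.
  refine finsum_mem_eq_of_bijOn (fun τ => τ⁻¹ * (g : G ⧸ (V : Subgroup G))) ⟨?_, ?_, ?_⟩
    (fun _ _ => rfl)
  · intro τ hτ
    change levelMap h (τ⁻¹ * (g : G ⧸ (V : Subgroup G))) = _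
    rw [map_mul, map_inv, (hrel τ).1 hτ, inv_one, one_mul]
    rfl
  · intro a _ b _ hab
    simpa using hab
  · intro a ha
    refine ⟨(g : G ⧸ (V : Subgroup G)) * a⁻¹, (hrel _).2 ?_, by simp⟩
    rw [map_mul, map_inv, show levelMap h a = g from ha, levelMap_mk, mul_inv_cancel]

variable {p} in
theorem normElt_mul_mem_kerProj_iff {V U : OpenSubgroup G} (h : V ≤ U)
    {x : CompletedGroupAlgebra p G} : normElt p G U V * x ∈ kerProj p V ↔ x ∈ kerProj p U := by
  rw [mem_kerProj, mem_kerProj]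
  constructor
  · intro hx
    ext g
    obtain ⟨g, rfl⟩ := QuotientGroup.mk_surjective g
    rw [← coeff_normElt_mul p h, hx]
    rfl
  · intro hx
    ext g
    obtain ⟨g, rfl⟩ := QuotientGroup.mk_surjective g
    rw [coeff_normElt_mul p h, hx]
    rfl

/-- The elements of `ℤ_p[G/V]` fixed by `U` are multiples of the norm element. -/
theorem exists_sub_normElt_mul_mem_kerProj {V U : OpenSubgroup G} (h : V ≤ U)
    {c : CompletedGroupAlgebra p G} (hc : ∀ u ∈ U, (grp p G u - 1) * c ∈ kerProj p V) :
    ∃ w, c - normElt p G U V * w ∈ kerProj p V := by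
  obtain ⟨w, hw⟩ := proj_surjective p U (MonoidAlgebra.ofCoeff (Finsupp.equivFunOnFinite.symm
    fun b => (proj p V c).coeff (b.out : G ⧸ (V : Subgroup G))))
  refine ⟨w, ?_⟩
  rw [mem_kerProj, map_sub, sub_eq_zero]
  ext g
  obtain ⟨g, rfl⟩ := QuotientGroup.mk_surjective g
  rw [coeff_normElt_mul p h, hw]
  obtain ⟨u, hu⟩ := QuotientGroup.mk_out_eq_mul (U : Subgroup G) g
  change _ = (proj p V c).coeff (((g : G ⧸ (U : Subgroup G)).out : G) : G ⧸ (V : Subgroup G))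
  rw [hu]
  have h1 := hc (u⁻¹ : G) (U.inv_mem u.2)
  rw [mem_kerProj, map_mul, map_sub, map_one, sub_mul, one_mul, sub_eq_zero, proj_grp] at h1
  have h2 := congrArg (fun z => MonoidAlgebra.coeff z (g : G ⧸ (V : Subgroup G))) h1
  simp only [coeff_of_mul] at h2
  rw [← h2, QuotientGroup.mk_inv, inv_inv, mul_comm g, QuotientGroup.mk_mul]

theorem AddCircle.exists_eq_div_of_nsmul_eq_zero {N : ℕ} (hN : N ≠ 0) {t : AddCircle (1 : ℚ)}
    (ht : N • t = 0) : ∃ k : ℤ, t = ((k / N : ℚ) : AddCircle (1 : ℚ)) := by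
  induction t using QuotientAddGroup.induction_on with | H q => ?_
  have h1 : ((N • q : ℚ) : AddCircle (1 : ℚ)) = 0 := ht
  obtain ⟨k, hk⟩ := (AddCircle.coe_eq_zero_iff (1 : ℚ)).1 h1
  refine ⟨k, ?_⟩
  have hN' : (N : ℚ) ≠ 0 := by exact_mod_cast hN
  have : q = k / N := by
    field_simp
    simpa [mul_comm] using hk.symm
  rw [this]

/-- Self-duality of the finite ring `ℤ/p^n[G/V]`: an element outside an ideal `J` is not killed by
the annihilator of `J`. -/
theorem exists_mul_mem_levelIdeal_of_notMem (V : OpenSubgroup G) (n : ℕ)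
    {J : Ideal (CompletedGroupAlgebra p G)} (hJ : levelIdeal p V n ≤ J)
    {y : CompletedGroupAlgebra p G} (hy : y ∉ J) :
    ∃ x, (∀ j ∈ J, x * j ∈ levelIdeal p V n) ∧ x * y ∉ levelIdeal p V n := by
  have hfin := Fintype.ofFinite (G ⧸ (V : Subgroup G))
  have hp0 : (p : ℕ) ^ n ≠ 0 := pow_ne_zero _ (Fact.out : p.Prime).ne_zero
  have hy0 : Ideal.Quotient.mk J y ≠ 0 := fun h0 => hy (Ideal.Quotient.eq_zero_iff_mem.1 h0)
  -- A ℚ/ℤ-valued character of R/J not vanishing at y. It is pulled back to R and then represented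
  -- as multiplication by an element x followed by a coefficient.
  obtain ⟨χ₀, hχ₀⟩ := CharacterModule.exists_character_apply_ne_zero_of_ne_zero hy0
  let χ : CompletedGroupAlgebra p G →+ AddCircle (1 : ℚ) :=
    (χ₀ : (CompletedGroupAlgebra p G ⧸ J) →+ AddCircle (1 : ℚ)).comp
      (Ideal.Quotient.mk J).toAddMonoidHom
  have hχJ : ∀ j ∈ J, χ j = 0 := fun j hj => by
    change χ₀ (Ideal.Quotient.mk J j) = 0
    rw [Ideal.Quotient.eq_zero_iff_mem.2 hj, map_zero]
  have hk : ∀ a : G ⧸ (V : Subgroup G), ∃ k : ℤ,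
      χ (grp p G a.out) = ((k / (p ^ n : ℕ) : ℚ) : AddCircle (1 : ℚ)) := by
    intro a
    refine AddCircle.exists_eq_div_of_nsmul_eq_zero hp0 ?_
    rw [← map_nsmul]
    refine hχJ _ (hJ ?_)
    rw [nsmul_eq_mul, Nat.cast_pow]
    exact Ideal.mul_mem_right _ _ (pow_mem_levelIdeal p V n)
  choose k hk using hk
  -- Since p ^ n kills R/J, χ takes the value k a / p ^ n on the group element a, so χ z is the
  -- class of ∑ k a · z_a / p ^ n. The coefficients z_a enter only modulo p ^ n and may be replaced
  -- by natural numbers m a.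
  have key : ∀ z, χ z = 0 ↔ (p : ℤ_[p]) ^ n ∣ ∑ a, (k a : ℤ_[p]) * (proj p V z).coeff a := by
    intro z
    have hm : ∀ a, ∃ m : ℕ, (p : ℤ_[p]) ^ n ∣ (proj p V z).coeff a - m := fun a =>
      ⟨_, Ideal.mem_span_singleton.1 (PadicInt.appr_spec n ((proj p V z).coeff a))⟩
    choose m hm using hm
    have hz : z - ∑ a, m a • grp p G a.out ∈ levelIdeal p V n := by
      rw [mem_levelIdeal, ← map_natCast (algebraMap ℤ_[p] _), ← map_pow,
        algebraMap_dvd_monoidAlgebra_iff]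
      intro a
      convert hm a using 1
      rw [map_sub, map_sum, MonoidAlgebra.coeff_sub, Finsupp.sub_apply, MonoidAlgebra.coeff_sum,
        Finsupp.finsetSum_apply]
      congr 1
      rw [Finset.sum_eq_single a]
      · rw [map_nsmul, proj_grp, QuotientGroup.out_eq', MonoidAlgebra.of_apply]
        simp
      · intro b _ hb
        rw [map_nsmul, proj_grp, QuotientGroup.out_eq', MonoidAlgebra.of_apply]
        simp [hb]
      · simp
    have hχz : χ z = (((∑ a, (m a : ℤ) * k a : ℤ) / (p ^ n : ℕ) : ℚ) : AddCircle (1 : ℚ)) := by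
      have h1 := hχJ _ (hJ hz)
      rw [map_sub, sub_eq_zero] at h1
      rw [h1, map_sum]
      simp_rw [map_nsmul, hk, ← AddCircle.coe_nsmul]
      refine (map_sum (QuotientAddGroup.mk' (AddSubgroup.zmultiples (1 : ℚ))) _ _).symm.trans ?_
      refine congrArg (QuotientAddGroup.mk' (AddSubgroup.zmultiples (1 : ℚ))) ?_
      push_cast
      rw [Finset.sum_div]
      refine Finset.sum_congr rfl fun a _ => ?_
      rw [nsmul_eq_mul, mul_div_assoc]
    have hd1 : χ z = 0 ↔ ((p ^ n : ℕ) : ℤ) ∣ ∑ a, (m a : ℤ) * k a := by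
      rw [hχz, AddCircle.coe_eq_zero_iff]
      have hN' : ((p ^ n : ℕ) : ℚ) ≠ 0 := by exact_mod_cast hp0
      constructor
      · rintro ⟨l, hl⟩
        refine ⟨l, ?_⟩
        rw [zsmul_eq_mul, mul_one, eq_div_iff hN'] at hl
        have : (l * (p ^ n : ℕ) : ℤ) = ∑ a, (m a : ℤ) * k a := by exact_mod_cast hl
        rw [← this, mul_comm]
      · rintro ⟨l, hl⟩
        refine ⟨l, ?_⟩
        rw [hl, zsmul_eq_mul, mul_one, eq_div_iff hN']
        push_cast
        ring
    rw [hd1]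
    have hd2 : (p : ℤ_[p]) ^ n ∣ ∑ a, (k a : ℤ_[p]) * (proj p V z).coeff a -
        ((∑ a, (m a : ℤ) * k a : ℤ) : ℤ_[p]) := by
      push_cast
      rw [← Finset.sum_sub_distrib]
      refine Finset.dvd_sum fun a _ => ?_
      rw [mul_comm (m a : ℤ_[p]), ← mul_sub]
      exact dvd_mul_of_dvd_right (hm a) _
    rw [← dvd_iff_dvd_of_dvd_sub (dvd_sub_comm.1 hd2)]
    rw [Nat.cast_pow, ← PadicInt.norm_int_le_pow_iff_dvd, PadicInt.norm_le_pow_iff_mem_span_pow,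
      Ideal.mem_span_singleton]
  -- With the inverse in the index, the coefficient of x z at g is the pairing of k with g⁻¹ z. So x
  -- z vanishes modulo p ^ n exactly when χ kills all translates of z, which holds on the ideal J
  -- and fails at y already for g = 1.
  obtain ⟨x, hx⟩ := proj_surjective p V (MonoidAlgebra.ofCoeff (Finsupp.equivFunOnFinite.symm
    fun b => (k b⁻¹ : ℤ_[p])))
  have hcoeff : ∀ (z : CompletedGroupAlgebra p G) (g : G), (proj p V (x * z)).coeff g =
      ∑ a, (k a : ℤ_[p]) * (proj p V (grp p G g⁻¹ * z)).coeff a := by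
    intro z g
    rw [map_mul, coeff_mul_eq_sum, hx, ← Equiv.sum_comp (Equiv.inv _)]
    refine Finset.sum_congr rfl fun a _ => ?_
    rw [map_mul (proj p V), proj_grp, coeff_of_mul,
      QuotientGroup.mk_inv, inv_inv, mul_comm (g : G ⧸ (V : Subgroup G))]
    simp
  have hmem : ∀ z, x * z ∈ levelIdeal p V n ↔ ∀ g : G, χ (grp p G g⁻¹ * z) = 0 := by
    intro z
    rw [mem_levelIdeal, ← map_natCast (algebraMap ℤ_[p] _), ← map_pow,
      algebraMap_dvd_monoidAlgebra_iff]
    simp_rw [key, ← hcoeff]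
    exact QuotientGroup.mk_surjective.forall
  refine ⟨x, fun j hj => (hmem j).2 fun g => hχJ _ (J.mul_mem_left _ hj), fun hxy => hχ₀ ?_⟩
  have := (hmem y).1 hxy 1
  rwa [inv_one, map_one, one_mul] at this

end Ideals

/-! ### Coinvariants and their direct limit in terms of norm elements -/

section Modules

variable (p : ℕ) [Fact p.Prime] (G : Type u) [CommGroup G] [TopologicalSpace G]
variable (M : Type v) [AddCommGroup M] [Module (CompletedGroupAlgebra p G) M]

theorem coinvariantsKer_eq (U : OpenSubgroup G) :
    coinvariantsKer p G M U = augIdeal p U • (⊤ : Submodule (CompletedGroupAlgebra p G) M) := by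
  refine le_antisymm (Submodule.span_le.2 ?_) (Submodule.smul_le.2 fun r hr m _ => ?_)
  · rintro _ ⟨u, hu, m, rfl⟩
    have : grp p G u • m - m = (grp p G u - 1) • m := by rw [sub_smul, one_smul]
    rw [SetLike.mem_coe, this]
    exact Submodule.smul_mem_smul (Ideal.subset_span ⟨u, hu, rfl⟩) trivial
  · induction hr using Submodule.span_induction with
    | mem x hx =>
      obtain ⟨u, hu, rfl⟩ := hx
      rw [sub_smul, one_smul]
      exact Submodule.subset_span ⟨u, hu, m, rfl⟩
    | zero => rw [zero_smul]; exact zero_mem _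
    | add x y _ _ hx hy => rw [add_smul]; exact add_mem hx hy
    | smul a x _ hx => rw [smul_assoc]; exact Submodule.smul_mem _ _ hx

variable {p G M}

theorem Coinvariants.mk_eq_zero_iff {U : OpenSubgroup G} {m : M} :
    Coinvariants.mk p G M U m = 0 ↔ m ∈ coinvariantsKer p G M U :=
  Submodule.Quotient.mk_eq_zero _

theorem Coinvariants.mk_surjective (U : OpenSubgroup G) :
    Function.Surjective (Coinvariants.mk p G M U) :=
  Submodule.mkQ_surjective _

variable [IsTopologicalGroup G] [CompactSpace G]

theorem normMap_mk (U V : OpenSubgroup G) (m : M) :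
    normMap p G M U V (Coinvariants.mk p G M U m) =
      Coinvariants.mk p G M V (normElt p G U V • m) := by
  have := Fintype.ofFinite (relQuotient G U V)
  change normEnd p G M U V (Coinvariants.mk p G M V m) = _
  rw [normEnd, normElt, finsum_eq_sum_of_fintype, finsum_eq_sum_of_fintype, Finset.sum_smul,
    map_sum, LinearMap.sum_apply]
  refine Finset.sum_congr rfl fun τ _ => ?_
  nth_rw 1 [← QuotientGroup.out_eq' (τ : G ⧸ (V : Subgroup G))]
  rfl

theorem normElt_mul_normElt_sub_mem {U V W : OpenSubgroup G} (hVU : V ≤ U) (hWV : W ≤ V) :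
    normElt p G V W * normElt p G U V - normElt p G U W ∈ kerProj p W := by
  rw [mem_kerProj, map_sub, sub_eq_zero]
  ext g
  obtain ⟨g, rfl⟩ := QuotientGroup.mk_surjective g
  rw [coeff_normElt_mul p hWV, ← mul_one (normElt p G U V), coeff_normElt_mul p hVU,
    ← mul_one (normElt p G U W), coeff_normElt_mul p (hWV.trans hVU)]

variable [IsNoetherianRing (CompletedGroupAlgebra p G)]

variable (p M) in
theorem coinvariantsKer_eq_kerProj_smul (U : OpenSubgroup G) :
    coinvariantsKer p G M U = kerProj p U • (⊤ : Submodule (CompletedGroupAlgebra p G) M) := by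
  rw [coinvariantsKer_eq, kerProj_eq_augIdeal]

theorem smul_mem_coinvariantsKer {U : OpenSubgroup G} {r : CompletedGroupAlgebra p G}
    (hr : r ∈ kerProj p U) (m : M) : r • m ∈ coinvariantsKer p G M U := by
  rw [coinvariantsKer_eq_kerProj_smul]
  exact Submodule.smul_mem_smul hr trivial

variable (p G M) in
theorem normMap_directedSystem :
    DirectedSystem (fun U : (OpenSubgroup G)ᵒᵈ => Coinvariants p G M (OrderDual.ofDual U))
      (fun U V _ => normMap p G M (OrderDual.ofDual U) (OrderDual.ofDual V)) where
  map_self U x := by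
    obtain ⟨m, rfl⟩ := Coinvariants.mk_surjective _ x
    rw [normMap_mk, ← sub_eq_zero, ← map_sub, Coinvariants.mk_eq_zero_iff]
    have : normElt p G (OrderDual.ofDual U) (OrderDual.ofDual U) • m - m =
      (normElt p G (OrderDual.ofDual U) (OrderDual.ofDual U) - 1) • m := by rw [sub_smul, one_smul]
    rw [this]
    refine smul_mem_coinvariantsKer ?_ m
    rw [mem_kerProj, map_sub, sub_eq_zero]
    ext g
    obtain ⟨g, rfl⟩ := QuotientGroup.mk_surjective g
    rw [← mul_one (normElt _ _ _ _), coeff_normElt_mul p le_rfl]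
  map_map U V W hUV hVW x := by
    obtain ⟨m, rfl⟩ := Coinvariants.mk_surjective _ x
    rw [normMap_mk, normMap_mk, normMap_mk, ← sub_eq_zero, ← map_sub, Coinvariants.mk_eq_zero_iff,
      smul_smul, ← sub_smul]
    exact smul_mem_coinvariantsKer (normElt_mul_normElt_sub_mem hUV hVW) m

variable (p G M) in
theorem subsingleton_coinvariantsLimit_iff :
    Subsingleton (CoinvariantsLimit p G M) ↔ ∀ (U : OpenSubgroup G) (m : M),
      ∃ V ≤ U, normElt p G U V • m ∈ coinvariantsKer p G M V := by
  classical
  have hds := normMap_directedSystem p G M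
  constructor
  · intro h U m
    obtain ⟨V, hUV, hV⟩ := Module.DirectLimit.of.zero_exact
      (R := CompletedGroupAlgebra p G) (ι := (OpenSubgroup G)ᵒᵈ)
      (G := fun U => Coinvariants p G M (OrderDual.ofDual U))
      (f := fun U V _ => normMap p G M (OrderDual.ofDual U) (OrderDual.ofDual V))
      (i := OrderDual.toDual U) (x := Coinvariants.mk p G M U m) (Subsingleton.elim _ _)
    refine ⟨OrderDual.ofDual V, hUV, ?_⟩
    rw [← Coinvariants.mk_eq_zero_iff, ← normMap_mk]
    exact hV
  · intro h
    refine ⟨fun x y => ?_⟩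
    suffices ∀ x : CoinvariantsLimit p G M, x = 0 by rw [this x, this y]
    intro x
    obtain ⟨U, x, rfl⟩ := Module.DirectLimit.exists_of x
    obtain ⟨m, rfl⟩ := Coinvariants.mk_surjective _ x
    obtain ⟨V, hV, hm⟩ := h (OrderDual.ofDual U) m
    rw [← Module.DirectLimit.of_f (hij := show U ≤ OrderDual.toDual V from hV)]
    rw [← Coinvariants.mk_eq_zero_iff, ← normMap_mk] at hm
    exact (congrArg _ hm).trans (map_zero _)

end Modules

/-- A finitely generated module supported at a prime `P` has a nonzero linear map to `R ⧸ P`. -/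
theorem exists_linearMap_quotient_ne_zero {R M : Type*} [CommRing R] [IsNoetherianRing R]
    [AddCommGroup M] [Module R M] [Module.Finite R M] (P : Ideal R) [P.IsPrime]
    (h : Module.annihilator R M ≤ P) : ∃ f : M →ₗ[R] R ⧸ P, f ≠ 0 := by
  have hsupp : (⟨P, ‹_›⟩ : PrimeSpectrum R) ∈ Module.support R M :=
    Module.mem_support_iff_of_finite.2 h
  have hnt : Nontrivial (LocalizedModule P.primeCompl M) := hsupp
  -- The finitely generated nonzero module M_P has a simple quotient, necessarily the residue field
  -- of P. The map M → Frac(R/P) so obtained lands in R/P after a denominator is cleared.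
  obtain ⟨N, hN, -⟩ := (eq_top_or_exists_le_coatom
    (⊥ : Submodule (Localization.AtPrime P) (LocalizedModule P.primeCompl M))).resolve_left
      bot_ne_top
  have hsimple := isSimpleModule_iff_isCoatom.2 hN
  obtain ⟨I, hI, ⟨e⟩⟩ := isSimpleModule_iff_quot_maximal.1 hsimple
  have hIm := IsLocalRing.eq_maximalIdeal hI
  subst hIm
  let g : M →ₗ[R] P.ResidueField :=
    ((e.toLinearMap.comp N.mkQ).restrictScalars R).comp (LocalizedModule.mkLinearMap P.primeCompl M)
  have hg : g ≠ 0 := by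
    intro hg0
    have h0 : ∀ x, e (N.mkQ x) = 0 := by
      intro x
      obtain ⟨⟨m, s⟩, hx⟩ := IsLocalizedModule.surj P.primeCompl
        (LocalizedModule.mkLinearMap P.primeCompl M) x
      have h1 : e (N.mkQ ((s : R) • x)) = 0 :=
        (congrArg (fun z => e (N.mkQ z)) hx).trans (LinearMap.congr_fun hg0 m)
      rw [← algebraMap_smul (Localization.AtPrime P), map_smul, map_smul] at h1
      exact (IsLocalization.map_units (Localization.AtPrime P) s).smul_eq_zero.1 h1
    obtain ⟨y, hy⟩ := e.surjective (1 : P.ResidueField)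
    obtain ⟨x, rfl⟩ := N.mkQ_surjective y
    exact one_ne_zero (α := P.ResidueField) (hy.symm.trans (h0 x))
  have hloc : IsLocalizedModule P.primeCompl (IsScalarTower.toAlgHom R (R ⧸ P)
      P.ResidueField).toLinearMap := by
    rw [isLocalizedModule_iff_isLocalization]
    have : Algebra.algebraMapSubmonoid (R ⧸ P) P.primeCompl = nonZeroDivisors (R ⧸ P) := by
      ext x
      obtain ⟨r, rfl⟩ := Ideal.Quotient.mk_surjective x
      rw [mem_nonZeroDivisors_iff_ne_zero, Ne, Ideal.Quotient.eq_zero_iff_mem]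
      refine ⟨?_, fun hr => ⟨r, hr, rfl⟩⟩
      rintro ⟨t, ht, htr⟩ hr
      have htr' : Ideal.Quotient.mk P t = Ideal.Quotient.mk P r := htr
      exact ht ((Submodule.sub_mem_iff_left P hr).1 (Ideal.Quotient.eq.1 htr'))
    rw [this]
    infer_instance
  have hfp : Module.FinitePresentation R M := Module.finitePresentation_of_finite R M
  obtain ⟨f, s, hfs⟩ := Module.FinitePresentation.exists_lift_of_isLocalizedModule P.primeCompl
    (IsScalarTower.toAlgHom R (R ⧸ P) P.ResidueField).toLinearMap g
  refine ⟨f, fun hf0 => hg ?_⟩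
  rw [hf0, LinearMap.comp_zero] at hfs
  ext m
  have h1 : (s : R) • g m = 0 := (LinearMap.congr_fun hfs m).symm
  rw [Algebra.smul_def, mul_eq_zero, Ideal.algebraMap_residueField_eq_zero] at h1
  exact h1.resolve_left s.2

/-! ### Annihilators of coinvariant-finite modules -/

section Annihilator

variable {p : ℕ} [Fact p.Prime] {G : Type u} [CommGroup G] [TopologicalSpace G]
variable {M : Type v} [AddCommGroup M] [Module (CompletedGroupAlgebra p G) M]

/-- The prime-to-p part of the order of N is a unit in ℤ_p. -/
theorem exists_pow_smul_eq_zero {N : Type*} [AddCommGroup N] [Module (CompletedGroupAlgebra p G) N]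
    [Finite N] : ∃ k : ℕ, ∀ x : N, (p : CompletedGroupAlgebra p G) ^ k • x = 0 := by
  obtain ⟨k, c, hc, hcard⟩ := Nat.exists_eq_pow_mul_and_not_dvd (n := Nat.card N)
    Nat.card_pos.ne' p (Fact.out : p.Prime).ne_one
  have hu : IsUnit (c : ℤ_[p]) := by
    rw [PadicInt.isUnit_iff, PadicInt.norm_natCast_eq_one_iff]
    exact (Nat.Prime.coprime_iff_not_dvd Fact.out).2 hc
  have hu' : IsUnit (c : CompletedGroupAlgebra p G) := by
    simpa using hu.map (algebraMap ℤ_[p] (CompletedGroupAlgebra p G))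
  refine ⟨k, fun x => hu'.smul_eq_zero.1 ?_⟩
  rw [smul_smul, mul_comm, ← Nat.cast_pow, ← Nat.cast_mul, ← hcard, Nat.cast_smul_eq_nsmul,
    card_nsmul_eq_zero']

variable [IsTopologicalGroup G] [CompactSpace G] [IsNoetherianRing (CompletedGroupAlgebra p G)]

variable (M) in
/-- For a coinvariant-finite finitely generated module, the annihilator contains an element
congruent to a power of `p` at each finite level. -/
theorem exists_mem_annihilator_sub_pow_mem_kerProj [Module.Finite (CompletedGroupAlgebra p G) M]
    (U : OpenSubgroup G) [Finite (Coinvariants p G M U)] :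
    ∃ (k : ℕ), ∃ f ∈ Module.annihilator (CompletedGroupAlgebra p G) M,
      f - (p : CompletedGroupAlgebra p G) ^ k ∈ kerProj p U := by
  obtain ⟨k, hk⟩ := exists_pow_smul_eq_zero (p := p) (G := G) (N := Coinvariants p G M U)
  set q : CompletedGroupAlgebra p G := (p : CompletedGroupAlgebra p G) ^ k with hq
  -- Cayley–Hamilton for multiplication by q = p ^ k, which maps M into I_U M: the lower
  -- coefficients of P lie in I_U, so P(q) kills M and is congruent to q ^ deg P modulo I_U.
  obtain ⟨P, hmonic, -, hcoeff, haeval⟩ :=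
    LinearMap.exists_monic_and_natDegree_eq_and_coeff_mem_pow_and_aeval_eq_zero
      (CompletedGroupAlgebra p G)
      (algebraMap (CompletedGroupAlgebra p G) (Module.End (CompletedGroupAlgebra p G) M) q)
      (kerProj p U) (by
        rintro _ ⟨m, rfl⟩
        rw [← coinvariantsKer_eq_kerProj_smul, ← Coinvariants.mk_eq_zero_iff]
        change Coinvariants.mk p G M U (q • m) = 0
        rw [map_smul, hk])
  refine ⟨k * P.natDegree, P.eval q, ?_, ?_⟩
  · rw [Module.mem_annihilator]
    intro m
    rw [Polynomial.aeval_algebraMap_apply] at haeval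
    have := LinearMap.congr_fun haeval m
    simpa using this
  · rw [Polynomial.eval_eq_sum_range, Finset.sum_range_succ, hmonic.coeff_natDegree, one_mul, hq,
      ← pow_mul, add_sub_cancel_right]
    refine sum_mem fun i hi => Ideal.mul_mem_right _ _ ?_
    rw [Finset.mem_range] at hi
    exact Ideal.pow_le_self (by omega) (hcoeff i)

end Annihilator

/-! ### Norm elements in ideals, and divisibility by descent -/

section Rings

variable {p : ℕ} [Fact p.Prime] {G : Type u} [CommGroup G] [TopologicalSpace G]
  [IsTopologicalGroup G] [CompactSpace G]

theorem mem_of_forall_mem_sup_levelIdeal {I : Ideal (CompletedGroupAlgebra p G)}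
    (hI : IsClosed (I : Set (CompletedGroupAlgebra p G))) {y : CompletedGroupAlgebra p G}
    (h : ∀ V n, y ∈ I ⊔ levelIdeal p V n) : y ∈ I := by
  rw [← SetLike.mem_coe, ← hI.closure_eq, mem_closure_iff_nhds]
  intro W hW
  have h0 : (fun z => y - z) ⁻¹' W ∈ 𝓝 (0 : CompletedGroupAlgebra p G) :=
    (continuous_const.sub continuous_id).continuousAt.preimage_mem_nhds (by simpa using hW)
  obtain ⟨V, n, hV⟩ := exists_levelIdeal_subset h0
  obtain ⟨i, hi, l, hl, hil⟩ := Submodule.mem_sup.1 (h V n)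
  refine ⟨i, ?_, hi⟩
  have := hV hl
  rwa [Set.mem_preimage, ← hil, add_sub_cancel_right] at this

/-- Work in the finite ring ℤ/p^n[G/V], where J below is g · Ann(f), and put j = n - k. If p ^ j ν
lies in J, multiplying by f and cancelling p ^ n gives the first alternative. Otherwise duality
yields x with x J = 0 and x p ^ j ν ≠ 0; then g x kills Ann(f), so g x ∈ (f) by the double
annihilator property. -/
theorem exists_normElt_sub_mem_or {U V : OpenSubgroup G} (hVU : V ≤ U) {k n : ℕ} (hkn : k ≤ n)
    {f g : CompletedGroupAlgebra p G}
    (hf : f - (p : CompletedGroupAlgebra p G) ^ k ∈ kerProj p U) :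
    (∃ a c, normElt p G U V - (g * a + f * c) ∈ kerProj p V) ∨
      ∃ x, g * x ∈ Ideal.span {f} ⊔ levelIdeal p V n ∧ x ∉ levelIdeal p U k := by
  set ν := normElt p G U V with hν
  let J : Ideal (CompletedGroupAlgebra p G) :=
    { carrier := {y | ∃ θ, f * θ ∈ levelIdeal p V n ∧ y - g * θ ∈ levelIdeal p V n}
      zero_mem' := ⟨0, by simp, by simp⟩
      add_mem' := by
        rintro y z ⟨θ, h1, h2⟩ ⟨η, h3, h4⟩
        refine ⟨θ + η, ?_, ?_⟩
        · rw [mul_add]; exact add_mem h1 h3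
        · rw [mul_add, add_sub_add_comm]; exact add_mem h2 h4
      smul_mem' := by
        rintro r y ⟨θ, h1, h2⟩
        refine ⟨r * θ, ?_, ?_⟩
        · rw [mul_left_comm]; exact Ideal.mul_mem_left _ _ h1
        · rw [smul_eq_mul, mul_left_comm, ← mul_sub]; exact Ideal.mul_mem_left _ _ h2 }
  have hJ : levelIdeal p V n ≤ J := fun y hy => ⟨0, by simp, by simpa using hy⟩
  obtain ⟨j, rfl⟩ := Nat.exists_eq_add_of_le hkn
  by_cases hmem : (p : CompletedGroupAlgebra p G) ^ j * ν ∈ J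
  · left
    obtain ⟨θ, h1, h2⟩ := hmem
    obtain ⟨a, ha⟩ := mem_levelIdeal_iff_exists.1 h1
    obtain ⟨c, hc⟩ := mem_levelIdeal_iff_exists.1 h2
    refine ⟨a, c, mem_kerProj_of_pow_mul_mem (n := k + j) ?_⟩
    have hfν : ν * (f - (p : CompletedGroupAlgebra p G) ^ k) ∈ kerProj p V :=
      (normElt_mul_mem_kerProj_iff hVU).2 hf
    have h3 := sub_mem (add_mem (Ideal.mul_mem_left _ f hc) (Ideal.mul_mem_left _ g ha))
      (Ideal.mul_mem_left _ ((p : CompletedGroupAlgebra p G) ^ j) hfν)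
    convert h3 using 1
    ring
  · right
    obtain ⟨x, hxJ, hx⟩ := exists_mul_mem_levelIdeal_of_notMem p V (k + j) hJ hmem
    refine ⟨x, ?_, fun hxU => hx ?_⟩
    · by_contra hgx
      obtain ⟨z, hz, hzx⟩ := exists_mul_mem_levelIdeal_of_notMem p V (k + j) le_sup_right hgx
      refine hzx ?_
      have := hxJ (g * z) ⟨z, ?_, by simp⟩
      · convert this using 1
        ring
      · rw [mul_comm]
        exact hz f (Ideal.mem_sup_left (Ideal.mem_span_singleton_self f))
    -- If x were divisible by p ^ k at level U, then ν x would be so at level V, and p ^ j ν x would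
    -- vanish modulo p ^ (k + j).
    · obtain ⟨y, hy⟩ := mem_levelIdeal_iff_exists.1 hxU
      have h1 : ν * (x - (p : CompletedGroupAlgebra p G) ^ k * y) ∈ kerProj p V :=
        (normElt_mul_mem_kerProj_iff hVU).2 hy
      refine mem_levelIdeal_iff_exists.2 ⟨ν * y, ?_⟩
      convert Ideal.mul_mem_left _ ((p : CompletedGroupAlgebra p G) ^ j) h1 using 1
      ring

variable [IsNoetherianRing (CompletedGroupAlgebra p G)]

/-- If `g` is regular modulo `f`, and `f` is invertible at level `U` up to `p`, then a norm element
lies in `(f, g)` at some finite level. -/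
theorem exists_normElt_sub_mem {U : OpenSubgroup G} {k : ℕ} {f g : CompletedGroupAlgebra p G}
    (hf : f - (p : CompletedGroupAlgebra p G) ^ k ∈ kerProj p U) (hg : ∀ x, f ∣ g * x → f ∣ x) :
    ∃ V ≤ U, ∃ a c, normElt p G U V - (g * a + f * c) ∈ kerProj p V := by
  by_contra! hcon
  -- The witnesses x of the second alternative form nonempty compact sets, decreasing in the level.
  -- The infimum with U and the shift by k keep V ≤ U and k ≤ n. A common point x has g x ∈ (f),
  -- hence f ∣ x, although f ∈ `levelIdeal p U k` and x is not.
  let S : (OpenSubgroup G)ᵒᵈ × ℕ → Set (CompletedGroupAlgebra p G) := fun i =>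
    {x | g * x ∈ Ideal.span {f} ⊔ levelIdeal p (OrderDual.ofDual i.1 ⊓ U) (k + i.2)} ∩
      {x | x ∈ levelIdeal p U k}ᶜ
  have hSc : ∀ i, IsClosed (S i) := fun i => by
    refine IsClosed.inter ?_ (isOpen_levelIdeal U k).isClosed_compl
    have : IsClosed ((Ideal.span {f} ⊔ levelIdeal p (OrderDual.ofDual i.1 ⊓ U) (k + i.2) :
        Ideal (CompletedGroupAlgebra p G)) : Set (CompletedGroupAlgebra p G)) :=
      isClosed_of_fg (IsNoetherian.noetherian _)
    exact this.preimage (continuous_const.mul continuous_id)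
  have hSa : Antitone S := fun i j hij x hx =>
    ⟨sup_le_sup_left (levelIdeal_mono p (inf_le_inf_right U hij.1) (Nat.add_le_add_left hij.2 k)) _
      hx.1, hx.2⟩
  obtain ⟨x, hx⟩ := IsCompact.nonempty_iInter_of_directed_nonempty_isCompact_isClosed S
    hSa.directed_ge
    (fun i => by
      rcases exists_normElt_sub_mem_or (V := OrderDual.ofDual i.1 ⊓ U) inf_le_right
        (Nat.le_add_right k i.2) (g := g) hf with ⟨a, c, hac⟩ | ⟨x, hx1, hx2⟩
      · exact absurd hac (hcon _ inf_le_right a c)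
      · exact ⟨x, hx1, hx2⟩)
    (fun i => (hSc i).isCompact) hSc
  rw [Set.mem_iInter] at hx
  have hgx : g * x ∈ Ideal.span {f} := by
    refine mem_of_forall_mem_sup_levelIdeal (isClosed_of_fg (IsNoetherian.noetherian _))
      fun V n => ?_
    exact sup_le_sup_left (levelIdeal_mono p inf_le_left (Nat.le_add_left n k)) _
      (hx (OrderDual.toDual V, n)).1
  obtain ⟨z, rfl⟩ := hg x (Ideal.mem_span_singleton.1 hgx)
  refine (hx (OrderDual.toDual U, 0)).2 ((levelIdeal p U k).mul_mem_right _ ?_)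
  rw [← sub_add_cancel f ((p : CompletedGroupAlgebra p G) ^ k)]
  exact add_mem (kerProj_le_levelIdeal p U k hf) (pow_mem_levelIdeal p U k)

/-- A divisibility criterion in `ℤ_p⟦G⟧` in terms of norm elements. -/
theorem dvd_of_forall_exists_normElt [IsDomain (CompletedGroupAlgebra p G)]
    {a b s : CompletedGroupAlgebra p G} (hb : b ≠ 0)
    (hf : ∀ V : OpenSubgroup G, ∃ (l : ℕ) (f : CompletedGroupAlgebra p G), b ∣ f * a ∧
      f - (p : CompletedGroupAlgebra p G) ^ l ∈ kerProj p V)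
    (hs : ∀ U : OpenSubgroup G, ∃ V ≤ U, ∃ κ ∈ kerProj p V, b ∣ (normElt p G U V * s - κ) * a) :
    b ∣ s * a := by
  rw [← Ideal.mem_span_singleton]
  refine mem_of_isClosed_of_forall_proj (C := ((Ideal.span {b} :
    Ideal (CompletedGroupAlgebra p G)) : Set (CompletedGroupAlgebra p G)))
    (isClosed_of_fg (IsNoetherian.noetherian _)) fun U => ?_
  obtain ⟨V, hVU, κ, hκ, c, hc⟩ := hs U
  obtain ⟨l, f, ⟨e, he⟩, hfl⟩ := hf V
  set ν := normElt p G U V with hν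
  -- Here f a = b e and (ν s - κ) a = b c. Modulo I_V this reads f c = ν s e, which is U-invariant;
  -- as f is regular there, c is U-invariant and so a multiple ν w.
  have h1 : ν * s * e = e * κ + c * f := by
    refine mul_left_cancel₀ hb ?_
    linear_combination f * hc - (ν * s - κ) * he
  have h2 : ∀ u ∈ U, (grp p G u - 1) * c ∈ kerProj p V := by
    intro u hu
    refine mem_kerProj_of_mul_mem hfl ?_
    have h3 : f * ((grp p G u - 1) * c) = s * e * (ν * (grp p G u - 1)) -
        (grp p G u - 1) * e * κ := by linear_combination -(grp p G u - 1) * h1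
    rw [h3]
    exact sub_mem (Ideal.mul_mem_left _ _ ((normElt_mul_mem_kerProj_iff hVU).2
      (grp_sub_one_mem_kerProj p hu))) (Ideal.mul_mem_left _ _ hκ)
  obtain ⟨w, hw⟩ := exists_sub_normElt_mul_mem_kerProj p hVU h2
  -- Injectivity of ν from level U to level V cancels ν; cancelling f at level U then gives s a ≡ b
  -- w modulo I_U.
  have h4 : s * e - f * w ∈ kerProj p U := by
    rw [← normElt_mul_mem_kerProj_iff hVU]
    have h5 : ν * (s * e - f * w) = e * κ + f * (c - ν * w) := by linear_combination h1
    rw [h5]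
    exact add_mem (Ideal.mul_mem_left _ _ hκ) (Ideal.mul_mem_left _ _ hw)
  have h6 : s * a - b * w ∈ kerProj p U := by
    refine mem_kerProj_of_mul_mem (kerProj_mono p hVU hfl) ?_
    have h7 : f * (s * a - b * w) = b * (s * e - f * w) := by linear_combination s * he
    rw [h7]
    exact Ideal.mul_mem_left _ _ h4
  refine ⟨b * w, Ideal.mul_mem_right _ _ (Ideal.mem_span_singleton_self b), ?_⟩
  rw [mem_kerProj, map_sub, sub_eq_zero] at h6
  exact h6.symm

end Rings

/-! ### Topological Nakayama lemma -/

section Compact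

/-- In a compact module, `N + t M = M` for a closed submodule `N` and a topologically nilpotent `t`
forces `N = M`. -/
theorem eq_top_of_sup_smul_eq_top {R M : Type*} [CommRing R] [TopologicalSpace R] [AddCommGroup M]
    [Module R M] [TopologicalSpace M] [CompactSpace M] [IsTopologicalAddGroup M]
    [ContinuousSMul R M] {N : Submodule R M} (hN : IsClosed (N : Set M)) {t : R}
    (ht : IsTopologicallyNilpotent t) (h : ∀ x : M, ∃ y, x - t • y ∈ N) : N = ⊤ := by
  have hpow : ∀ (n : ℕ) (x : M), ∃ y, x - t ^ n • y ∈ N := by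
    intro n
    induction n with
    | zero => exact fun x => ⟨x, by simp⟩
    | succ n ih =>
      intro x
      obtain ⟨y, hy⟩ := ih x
      obtain ⟨z, hz⟩ := h y
      refine ⟨z, ?_⟩
      have : x - t ^ (n + 1) • z = (x - t ^ n • y) + t ^ n • (y - t • z) := by
        rw [smul_sub, smul_smul, pow_succ]; abel
      rw [this]
      exact add_mem hy (N.smul_mem _ hz)
  rw [eq_top_iff]
  intro x _
  rw [← SetLike.mem_coe, ← hN.closure_eq, mem_closure_iff_nhds]
  intro W hW
  have h0 : (fun z => x - z) ⁻¹' W ∈ 𝓝 (0 : M) :=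
    (continuous_const.sub continuous_id).continuousAt.preimage_mem_nhds (by simpa using hW)
  set O := interior ((fun z => x - z) ⁻¹' W) with hO
  have hopen : IsOpen {q : R × M | q.1 • q.2 ∈ O} := isOpen_interior.preimage continuous_smul
  -- Compactness of M makes r • m small uniformly in m as r → 0, so N meets every neighbourhood of
  -- x.
  obtain ⟨A, B, hA, -, hA0, hB, hAB⟩ := generalized_tube_lemma
    (isCompact_singleton (x := (0 : R))) (isCompact_univ (X := M)) hopen (by
      rintro ⟨r, m⟩ ⟨hr, -⟩
      change r • m ∈ O
      rw [show r = 0 from hr, zero_smul]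
      exact mem_interior_iff_mem_nhds.2 h0)
  obtain ⟨n, hn⟩ := (ht.eventually (hA.mem_nhds (hA0 rfl))).exists
  obtain ⟨y, hy⟩ := hpow n x
  have hyO : t ^ n • y ∈ O := hAB (a := (t ^ n, y)) ⟨hn, hB trivial⟩
  have hyW : x - t ^ n • y ∈ W :=
    interior_subset (s := (fun z => x - z) ⁻¹' W) hyO
  exact ⟨x - t ^ n • y, hyW, hy⟩

theorem eq_top_of_sup_span_smul_eq_top {R M : Type*} [CommRing R] [TopologicalSpace R]
    [AddCommGroup M] [Module R M] [TopologicalSpace M] [CompactSpace M] [T2Space M]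
    [IsTopologicalAddGroup M] [ContinuousSMul R M] (T : Finset R)
    (hT : ∀ t ∈ T, IsTopologicallyNilpotent t) {N : Submodule R M} (hN : IsClosed (N : Set M))
    (h : N ⊔ Ideal.span (T : Set R) • (⊤ : Submodule R M) = ⊤) : N = ⊤ := by
  classical
  induction T using Finset.induction_on generalizing N with
  | empty => simpa using h
  | insert t T _ ih =>
    have hcl : IsClosed ((N ⊔ Ideal.span {t} • (⊤ : Submodule R M) : Submodule R M) : Set M) := by
      have hc : IsCompact ((Ideal.span {t} • (⊤ : Submodule R M) : Submodule R M) : Set M) := by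
        have : ((Ideal.span {t} • (⊤ : Submodule R M) : Submodule R M) : Set M) =
            Set.range fun m : M => t • m := by
          rw [Submodule.ideal_span_singleton_smul]
          rw [Submodule.coe_pointwise_smul, Submodule.top_coe, ← Set.image_smul, Set.image_univ]
        rw [this]
        exact isCompact_range (continuous_const_smul t)
      rw [Submodule.coe_sup]
      exact (hN.isCompact.add hc).isClosed
    have h1 := ih (fun s hs => hT s (Finset.mem_insert_of_mem hs)) hcl (by
      rwa [Finset.coe_insert, Set.insert_eq, Ideal.span_union, Submodule.sup_smul,
        ← sup_assoc] at h)
    refine eq_top_of_sup_smul_eq_top hN (hT t (Finset.mem_insert_self _ _)) fun x => ?_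
    have hx : x ∈ N ⊔ Ideal.span {t} • (⊤ : Submodule R M) := by rw [h1]; trivial
    obtain ⟨n, hn, m, hm, rfl⟩ := Submodule.mem_sup.1 hx
    rw [Submodule.ideal_span_singleton_smul] at hm
    obtain ⟨y, -, rfl⟩ := hm
    exact ⟨y, by simpa using hn⟩

end Compact

/-! ### The two implications -/

section Main

variable {p : ℕ} [Fact p.Prime] {d : ℕ} {G : Type u} [CommGroup G] [TopologicalSpace G]
  [IsTopologicalGroup G]
variable {M : Type v} [AddCommGroup M] [Module (CompletedGroupAlgebra p G) M]

/-- A topological Nakayama lemma: compact modules with finite coinvariants are finitely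
generated. -/
theorem finite_of_isCompactModule (e : G ≃ₜ* Multiplicative (Fin d → ℤ_[p]))
    (hM : IsCompactModule p G M)
    (hfin : Finite (Coinvariants p G M ⊤)) : Module.Finite (CompletedGroupAlgebra p G) M := by
  have := compactSpace_of_equiv e
  have hnoeth := isNoetherianRing_of_equiv e
  obtain ⟨_, _, _, _, _⟩ := hM
  -- By Noetherianity finitely many of the topologically nilpotent u - 1 generate the augmentation
  -- ideal of G. Lifts of the finitely many elements of M_G then generate M.
  obtain ⟨T, hTs, hT⟩ := (Submodule.fg_span_iff_fg_span_finset_subset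
    {x : CompletedGroupAlgebra p G | ∃ u ∈ (⊤ : OpenSubgroup G), x = grp p G u - 1}).1
      (IsNoetherian.noetherian (R := CompletedGroupAlgebra p G) _)
  let S : Set M := Set.range fun y : Coinvariants p G M ⊤ =>
    (Coinvariants.mk_surjective (p := p) (M := M) ⊤ y).choose
  have hS : S.Finite := Set.finite_range _
  have hfg : (Submodule.span (CompletedGroupAlgebra p G) S).FG := Submodule.fg_span hS
  refine ⟨?_⟩
  rw [← eq_top_of_sup_span_smul_eq_top T (fun t ht => ?_) (isCompact_of_fg hfg).isClosed ?_]
  · exact hfg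
  · have hIT : Ideal.span (T : Set (CompletedGroupAlgebra p G)) = augIdeal p ⊤ := hT.symm
    rw [hIT, ← coinvariantsKer_eq, eq_top_iff]
    intro m _
    have hm := (Coinvariants.mk_surjective (p := p) (M := M) ⊤
      (Coinvariants.mk p G M ⊤ m)).choose_spec
    rw [← sub_eq_zero, ← map_sub, Coinvariants.mk_eq_zero_iff] at hm
    exact Submodule.mem_sup.2 ⟨_, Submodule.subset_span ⟨Coinvariants.mk p G M ⊤ m, rfl⟩, _,
      neg_mem hm, by rw [neg_sub]; exact add_sub_cancel _ m⟩
  · obtain ⟨u, -, rfl⟩ := hTs ht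
    exact isTopologicallyNilpotent_grp_sub_one e u

theorem subsingleton_coinvariantsLimit_of_isPseudoNull
    (e : G ≃ₜ* Multiplicative (Fin d → ℤ_[p]))
    (hfin : IsSystematicallyCoinvariantFinite p G M)
    (h : IsPseudoNull (CompletedGroupAlgebra p G) M) : Subsingleton (CoinvariantsLimit p G M) := by
  have := compactSpace_of_equiv e
  have := isNoetherianRing_of_equiv e
  have := isDomain_of_equiv e
  have hcic := isCompletelyIntegrallyClosed_of_equiv e
  obtain ⟨hM, hP⟩ := h
  have hann : ∀ P : Ideal (CompletedGroupAlgebra p G), P.IsPrime → P.height ≤ 1 →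
      ¬ Module.annihilator (CompletedGroupAlgebra p G) M ≤ P := by
    intro P hPp hPh hle
    have hmem : (⟨P, hPp⟩ : PrimeSpectrum (CompletedGroupAlgebra p G)) ∈
        Module.support (CompletedGroupAlgebra p G) M := Module.mem_support_iff_of_finite.2 hle
    have := hP ⟨P, hPp⟩ hPh
    exact not_nontrivial_iff_subsingleton.2 this hmem
  rw [subsingleton_coinvariantsLimit_iff]
  intro U m
  have := hfin U
  obtain ⟨k, f, hfA, hf⟩ := exists_mem_annihilator_sub_pow_mem_kerProj (p := p) M U
  have hf0 : f ≠ 0 := ne_zero_of_sub_pow_mem_kerProj hf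
  -- If every element of Ann M were a zero divisor modulo f, prime avoidance would place Ann M
  -- inside an associated prime of R/(f), of height at most one.
  obtain ⟨g, hgA, hg⟩ : ∃ g ∈ Module.annihilator (CompletedGroupAlgebra p G) M,
      ∀ x, f ∣ g * x → f ∣ x := by
    by_contra! hcon
    have hsub :
        (Module.annihilator (CompletedGroupAlgebra p G) M : Set (CompletedGroupAlgebra p G)) ⊆
        ⋃ P ∈ associatedPrimes (CompletedGroupAlgebra p G)
          (CompletedGroupAlgebra p G ⧸ Ideal.span {f}), (P : Set (CompletedGroupAlgebra p G)) := by
      rw [biUnion_associatedPrimes_eq_zero_divisors]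
      intro g hg
      obtain ⟨x, hx1, hx2⟩ := hcon g hg
      refine ⟨Ideal.Quotient.mk _ x, ?_, ?_⟩
      · rwa [Ne, Ideal.Quotient.eq_zero_iff_mem, Ideal.mem_span_singleton]
      · exact Ideal.Quotient.eq_zero_iff_mem.2 (Ideal.mem_span_singleton.2 hx1)
    obtain ⟨P, hPa, hPle⟩ := (Ideal.subset_union_prime_finite (associatedPrimes.finite _ _)
      (f := id) 0 0 fun _ h _ _ => h.isPrime).1 hsub
    exact hann P hPa.isPrime (hcic.height_le_one hf0 hPa) hPle
  obtain ⟨V, hVU, a, c, hac⟩ := exists_normElt_sub_mem hf hg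
  refine ⟨V, hVU, ?_⟩
  have h1 := smul_mem_coinvariantsKer hac m
  have h2 : (g * a + f * c) • m = 0 := by
    rw [add_smul, mul_comm g, mul_comm f, mul_smul, mul_smul, Module.mem_annihilator.1 hgA,
      Module.mem_annihilator.1 hfA, smul_zero, smul_zero, add_zero]
  rwa [sub_smul, h2, sub_zero] at h1

theorem isPseudoNull_of_subsingleton_coinvariantsLimit
    (e : G ≃ₜ* Multiplicative (Fin d → ℤ_[p]))
    [hM : Module.Finite (CompletedGroupAlgebra p G) M]
    (hfin : IsSystematicallyCoinvariantFinite p G M)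
    (h : Subsingleton (CoinvariantsLimit p G M)) : IsPseudoNull (CompletedGroupAlgebra p G) M := by
  have := compactSpace_of_equiv e
  have := isNoetherianRing_of_equiv e
  have := isDomain_of_equiv e
  rw [subsingleton_coinvariantsLimit_iff] at h
  refine ⟨hM, fun ⟨P, hPp⟩ hPh => ?_⟩
  by_contra hns
  have hle : Module.annihilator (CompletedGroupAlgebra p G) M ≤ P :=
    (Module.mem_support_iff_of_finite (p := ⟨P, hPp⟩)).1 (not_subsingleton_iff_nontrivial.1 hns)
  have hf : ∀ V : OpenSubgroup G, ∃ (l : ℕ) (f : CompletedGroupAlgebra p G), f ∈ P ∧ f ≠ 0 ∧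
      f - (p : CompletedGroupAlgebra p G) ^ l ∈ kerProj p V := by
    intro V
    have := hfin V
    obtain ⟨k, f, hfA, hf⟩ := exists_mem_annihilator_sub_pow_mem_kerProj (p := p) M V
    exact ⟨k, f, hle hfA, ne_zero_of_sub_pow_mem_kerProj hf, hf⟩
  -- Any level would do: only a nonzero element of P is needed, and P is then minimal over it
  -- because its height is at most one.
  obtain ⟨-, b, hbP, hb0, -⟩ := hf ⊤
  have hmin : P ∈ (Ideal.span {b}).minimalPrimes :=
    Ideal.mem_minimalPrimes_span_singleton_of_height_le_one hPh hbP hb0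
  have hass : P ∈ associatedPrimes (CompletedGroupAlgebra p G)
      (CompletedGroupAlgebra p G ⧸ Ideal.span {b}) := by
    refine Module.associatedPrimes.minimalPrimes_annihilator_subset_associatedPrimes _ _ ?_
    rwa [Ideal.annihilator_quotient]
  rw [AssociatedPrimes.mem_iff, isAssociatedPrime_iff] at hass
  obtain ⟨-, a, ha⟩ := hass
  obtain ⟨a, rfl⟩ := Ideal.Quotient.mk_surjective a
  have hmem : ∀ r, r ∈ P ↔ b ∣ r * a := by
    intro r
    rw [ha, Submodule.mem_colon_singleton, Submodule.mem_bot, ← Ideal.mem_span_singleton,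
      ← Ideal.Quotient.eq_zero_iff_mem]
    rfl
  obtain ⟨φ, hφ⟩ := exists_linearMap_quotient_ne_zero (M := M) P hle
  obtain ⟨m, hm⟩ : ∃ m, φ m ≠ 0 := by
    by_contra! h0
    exact hφ (LinearMap.ext h0)
  obtain ⟨s, hs⟩ := Ideal.Quotient.mk_surjective (φ m)
  refine hm ?_
  rw [← hs, Ideal.Quotient.eq_zero_iff_mem, hmem]
  refine dvd_of_forall_exists_normElt hb0 (fun V => ?_) fun U => ?_
  · obtain ⟨l, f, hfP, -, hfV⟩ := hf V
    exact ⟨l, f, (hmem f).1 hfP, hfV⟩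
  · obtain ⟨V, hVU, hV⟩ := h U m
    rw [coinvariantsKer_eq_kerProj_smul] at hV
    -- φ maps I_V M into the image of I_V in R/P, so ν s ≡ κ modulo P for some κ ∈ I_V.
    have himg : ∀ x ∈ kerProj p V • (⊤ : Submodule (CompletedGroupAlgebra p G) M),
        ∃ κ ∈ kerProj p V, φ x = Ideal.Quotient.mk P κ := by
      intro x hx
      induction hx using Submodule.smul_induction_on' with
      | smul r hr n _ =>
        obtain ⟨t, ht⟩ := Ideal.Quotient.mk_surjective (φ n)
        refine ⟨r * t, Ideal.mul_mem_right _ _ hr, ?_⟩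
        rw [map_smul, ← ht]
        rfl
      | add x _ y _ hx hy =>
        obtain ⟨κ, hκ, hx⟩ := hx
        obtain ⟨μ, hμ, hy⟩ := hy
        exact ⟨κ + μ, add_mem hκ hμ, by rw [map_add, map_add, hx, hy]⟩
    obtain ⟨κ, hκ, hκφ⟩ := himg _ hV
    refine ⟨V, hVU, κ, hκ, (hmem _).1 ?_⟩
    rw [← Ideal.Quotient.eq, ← hκφ, map_smul, ← hs]
    rfl

end Main

end Iwasawa

theorem mainTheorem6 (p : ℕ) [Fact p.Prime] (d : ℕ) (hd : 1 ≤ d)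
    (G : Type*) [CommGroup G] [TopologicalSpace G] [IsTopologicalGroup G]
    (hG : Nonempty (G ≃ₜ* Multiplicative (Fin d → ℤ_[p])))
    (M : Type*) [AddCommGroup M] [Module (Iwasawa.CompletedGroupAlgebra p G) M]
    (hM : Module.Finite (Iwasawa.CompletedGroupAlgebra p G) M ∨ Iwasawa.IsCompactModule p G M)
    (hfin : Iwasawa.IsSystematicallyCoinvariantFinite p G M) :
    Iwasawa.IsPseudoNull (Iwasawa.CompletedGroupAlgebra p G) M ↔
      Subsingleton (Iwasawa.CoinvariantsLimit p G M) := by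
  obtain ⟨e⟩ := hG
  have hM' : Module.Finite (Iwasawa.CompletedGroupAlgebra p G) M :=
    hM.elim id fun h => Iwasawa.finite_of_isCompactModule e h (hfin ⊤)
  exact ⟨Iwasawa.subsingleton_coinvariantsLimit_of_isPseudoNull e hfin,
    Iwasawa.isPseudoNull_of_subsingleton_coinvariantsLimit e hfin⟩
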